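/- **Conventions.** A *filtered space* $(X,\mathcal S)$ of formal dimension $n\ge 0$ is a space $X$ with closed subsets $\emptyset=X_{-1}\subseteq X_0\subseteq\dots\subseteq X_{n-1}\subsetneq X_n=X$. Its *strata* (the set of strata is $\mathcal S$) are the connected components of the sets $X^i=X_i\setminus X_{i-1}$; a stratum $S\subseteq X^i$ has $\dim S=i$ and $\operatorname{codim}S=n-i$, and it is *regular* if $i=n$, *singular* otherwise. Write $S\le Q$ if $S\subseteq\overline Q$. A *stratified map* is a continuous map sending each stratum $S$ into a stratum of codimension at most $\operatorname{codim}S$; a *stratified homeomorphism* is a homeomorphism that is stratified in both directions. If $L$ is a compact (Hausdorff) filtered space, the open cone $\mathring cL=L\times[0,1[\,/\,L\times\{0\}$, with apex $\mathtt v$, is filtered by $(\mathring cL)_i=\mathring c(L_{i-1})$ for $i\ge0$, where $\mathring c\emptyset=\{\mathtt v\}$; a product $U\times\mathring cL$ is filtered by $U\times(\mathring cL)_i$, and an open subset $V\subseteq X$ by $V\cap X_i$. A *CS set* of dimension $n$ is a Hausdorff filtered space of dimension $n$ such that each $X^i$ is a topological $i$-manifold (possibly empty) and each $x\in X^i$ with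 $i<n$ has an open neighbourhood $V$ in $X$, an open neighbourhood $U$ in $X^i$, a compact filtered space $L$ of formal dimension $n-i-1$, and a stratified homeomorphism $\varphi:U\times\mathring cL\to V$ with $\varphi(u,\mathtt v)=u$ for all $u\in U$. A *CS-coarsening* $(X,\mathcal S,\mathcal T)$ consists of two CS set structures on the same space $X$ such that every stratum of $\mathcal T$ is a union of strata of $\mathcal S$; for $S\in\mathcal S$, let $S^\iota\in\mathcal T$ be the stratum containing $S$. A *perversity* on $(X,\mathcal S)$ is a map $\bar p:\mathcal S\to\mathbb Z\sqcup\{\pm\infty\}$ that is $0$ on regular strata. The top perversity $\bar t$ satisfies $\bar t(S)=\operatorname{codim}S-2$ for singular $S$; the dual of $\bar p$ is $D\bar p=\bar t-\bar p$; perversities are compared stratum by stratum. For a CS-coarsening, $\iota_*\bar p$ is the perversity on $(X,\mathcal T)$ with $\iota_*\bar p(T)=\inf\{\bar p(Q): Q\in\mathcal S,\ Q^\iota=T\}$ for singular $T$. A perversity $\bar p$ on $(X,\mathcal S)$ is a *$K$-perversity* on $(X,\mathcal S,\mathcal T)$ if, for all $S,Q\in\mathcal S$ with $S^\iota=Q^\iota$: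 (K1) $\bar p(Q)\le\bar p(S)\le\bar p(Q)+\bar t(S)-\bar t(Q)$ whenever $S\le Q$; (K2) $\bar p(Q)=\bar p(S)$ whenever $\dim S=\dim Q$. A singular simplex $\sigma:\Delta\to X$ is *$\bar p$-allowable* if $\dim\sigma^{-1}(S)\le\dim\Delta-D\bar p(S)-2$ for each singular stratum $S$, where $\dim A$ is the least dimension of a polyhedron of $\Delta$ containing $A$, and $\dim\emptyset=-\infty$. It is *$\bar p$-full* if all its faces (itself included) are $\bar p$-allowable. The $\bar p$-full simplices form a simplicial subset $\mathcal G_{\bar p}(X,\mathcal S)$ of $\operatorname{Sing}X$, and $\pi_0^{\bar p}(X,\mathcal S)$ denotes its set of connected components. **Proposition 5.4.** Let $(X,\mathcal S,\mathcal T)$ be a CS-coarsening and let $\bar p$ be a $K$-perversity on it such that $\bar p\le\bar t$. Then $\mathcal G_{\bar p}(X,\mathcal S)\subseteq\mathcal G_{\iota_*\bar p}(X,\mathcal T)$, and this inclusion (the simplicial map given by the identity of $X$) induces a bijection $$\iota_0:\pi_0^{\bar p}(X,\mathcal S)\xrightarrow{\ \cong\ }\pi_0^{\iota_*\bar p}(X,\mathcal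 T).$$ -/

import Mathlib

open CategoryTheory Opposite

universe u

namespace CSCoarsening

/-! ### Filtered spaces and strata -/

/-- A filtration `∅ = X₋₁ ⊆ X₀ ⊆ ⋯ ⊆ Xₙ = X` of a topological space by closed subsets (the
skeleta), indexed by all integers for convenience; `n` is the formal dimension. -/
structure Filtration (X : Type*) [TopologicalSpace X] (n : ℕ) where
  skel : ℤ → Set X
  isClosed_skel : ∀ i, IsClosed (skel i)
  mono : Monotone skel
  skel_neg_one : skel (-1) = ∅
  skel_dim : skel n = Set.univ

namespace Filtration

variable {X Y : Type*} [TopologicalSpace X] [TopologicalSpace Y] {n m : ℕ}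

/-- A filtered space of formal dimension `n`: the inclusion `Xₙ₋₁ ⊆ Xₙ = X` is strict
(in particular `X` is non-empty). -/
def IsFilteredSpace (F : Filtration X n) : Prop := F.skel (n - 1) ≠ Set.univ

/-- The layer `Xⁱ = Xᵢ \ Xᵢ₋₁`. -/
def layer (F : Filtration X n) (i : ℤ) : Set X := F.skel i \ F.skel (i - 1)

/-- A stratum of formal dimension `dim`: a (non-empty) connected component of `X^dim`. -/
structure Stratum (F : Filtration X n) where
  dim : ℤ
  carrier : Set X
  isComponent : ∃ x ∈ F.layer dim, carrier = connectedComponentIn (F.layer dim) x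

namespace Stratum

variable {F : Filtration X n}

/-- The formal codimension. -/
def codim (S : F.Stratum) : ℤ := n - S.dim

/-- Regular strata are those in `X \ Xₙ₋₁`. -/
def IsRegular (S : F.Stratum) : Prop := S.dim = n

/-- A stratum is singular if it is not regular. -/
def IsSingular (S : F.Stratum) : Prop := ¬ S.IsRegular

/-- `S ≤ Q` if `S` lies in the closure of `Q`. -/
instance : LE F.Stratum := ⟨fun S Q => S.carrier ⊆ closure Q.carrier⟩

end Stratum

/-- A stratified map: a continuous map such that each stratum `S` is sent into a stratum `T`
with `codim T ≤ codim S`. -/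
def IsStratifiedMap (F : Filtration X n) (G : Filtration Y m) (f : X → Y) : Prop :=
  Continuous f ∧ ∀ S : F.Stratum, ∃ T : G.Stratum,
    Set.MapsTo f S.carrier T.carrier ∧ T.codim ≤ S.codim

/-- A stratified homeomorphism: both the map and its inverse are stratified. -/
def IsStratifiedHomeo (F : Filtration X n) (G : Filtration Y m) (e : X ≃ₜ Y) : Prop :=
  IsStratifiedMap F G e ∧ IsStratifiedMap G F e.symm

/-- The induced filtration on a subspace (used for open subsets). -/
def induced (F : Filtration X n) (V : Set X) : Filtration V n where
  skel i := Subtype.val ⁻¹' F.skel i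
  isClosed_skel i := (F.isClosed_skel i).preimage continuous_subtype_val
  mono _ _ h := Set.preimage_mono (F.mono h)
  skel_neg_one := by rw [F.skel_neg_one, Set.preimage_empty]
  skel_dim := by rw [F.skel_dim, Set.preimage_univ]

/-- The product filtration `(Y × X)ᵢ = Y × Xᵢ`. -/
def prodLeft (Y : Type*) [TopologicalSpace Y] (F : Filtration X n) : Filtration (Y × X) n where
  skel i := Prod.snd ⁻¹' F.skel i
  isClosed_skel i := (F.isClosed_skel i).preimage continuous_snd
  mono _ _ h := Set.preimage_mono (F.mono h)
  skel_neg_one := by rw [F.skel_neg_one, Set.preimage_empty]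
  skel_dim := by rw [F.skel_dim, Set.preimage_univ]

end Filtration

/-! ### Open cones -/

/-- The relation on `L × [0, 1[` which collapses `L × {0}` to a point. -/
def coneSetoid (L : Type*) : Setoid (L × Set.Ico (0 : ℝ) 1) where
  r a b := a = b ∨ ((a.2 : ℝ) = 0 ∧ (b.2 : ℝ) = 0)
  iseqv :=
    { refl := fun _ => Or.inl rfl
      symm := by
        rintro a b (h | ⟨h, h'⟩)
        · exact Or.inl h.symm
        · exact Or.inr ⟨h', h⟩
      trans := by
        rintro a b c (rfl | ⟨h, h'⟩) (rfl | ⟨k, k'⟩)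
        · exact Or.inl rfl
        · exact Or.inr ⟨k, k'⟩
        · exact Or.inr ⟨h, h'⟩
        · exact Or.inr ⟨h, k'⟩ }

/-- The open cone `L × [0, 1[ / L × {0}` with the quotient topology
(used only for non-empty `L`). -/
abbrev OpenCone (L : Type*) : Type _ := Quotient (coneSetoid L)

namespace OpenCone

variable {L : Type*}

/-- The point `[l, t]` of the cone. -/
def mk (l : L) (t : Set.Ico (0 : ℝ) 1) : OpenCone L := Quotient.mk (coneSetoid L) (l, t)

/-- The apex `[l, 0]`, which does not depend on `l`. -/
def apex (l : L) : OpenCone L := mk l ⟨0, by norm_num⟩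

end OpenCone

/-- The cone filtration `(c L)ᵢ = c (Lᵢ₋₁)` for `0 ≤ i ≤ m + 1`, where the cone on the empty set
is the apex. -/
def Filtration.cone {L : Type*} [TopologicalSpace L] {m : ℕ} (F : Filtration L m) :
    Filtration (OpenCone L) (m + 1) where
  skel i := {c | 0 ≤ i ∧ ∃ l t, c = OpenCone.mk l t ∧ ((t : ℝ) = 0 ∨ l ∈ F.skel (i - 1))}
  isClosed_skel i := by
    by_cases hi : 0 ≤ i
    · have hq : Topology.IsQuotientMap
          (Quotient.mk (coneSetoid L) : L × Set.Ico (0 : ℝ) 1 → OpenCone L) :=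
        isQuotientMap_quot_mk
      refine hq.isClosed_preimage.1 ?_
      have : (Quotient.mk (coneSetoid L) : L × Set.Ico (0 : ℝ) 1 → OpenCone L) ⁻¹'
          {c | 0 ≤ i ∧ ∃ l t, c = OpenCone.mk l t ∧ ((t : ℝ) = 0 ∨ l ∈ F.skel (i - 1))} =
          {a : L × Set.Ico (0 : ℝ) 1 | (a.2 : ℝ) = 0} ∪ Prod.fst ⁻¹' F.skel (i - 1) := by
        ext ⟨l, t⟩
        constructor
        · rintro ⟨-, l', t', h, h'⟩
          rcases Quotient.exact h with h | ⟨h, -⟩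
          · obtain ⟨rfl, rfl⟩ := Prod.mk.inj h
            exact h'
          · exact Or.inl h
        · intro h
          exact ⟨hi, l, t, rfl, h⟩
      rw [this]
      exact (isClosed_eq (continuous_subtype_val.comp continuous_snd) continuous_const).union
        ((F.isClosed_skel _).preimage continuous_fst)
    · simp [hi]
  mono i j hij := by
    rintro c ⟨hi, l, t, h, h'⟩
    exact ⟨hi.trans hij, l, t, h, h'.imp id fun hl => F.mono (by omega) hl⟩
  skel_neg_one := by simp
  skel_dim := by
    ext c
    induction c using Quotient.inductionOn with
    | h a =>
      refine ⟨fun _ => trivial, fun _ => ⟨by positivity, a.1, a.2, rfl, Or.inr ?_⟩⟩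
      have h : ((m + 1 : ℕ) : ℤ) - 1 = m := by push_cast; ring
      rw [h, F.skel_dim]
      trivial

/-! ### CS sets and coarsenings -/

/-- A conical chart at the point `x` of `Xⁱ`: an open neighbourhood `V` of `x` in `X`, an open
neighbourhood `U` of `x` in `Xⁱ`, a compact Hausdorff filtered space `L` of formal dimension
`n - i - 1` (the link), and a stratified homeomorphism `φ : U × c L → V` with `φ (u, apex) = u`. -/
def HasConicalChart {X : Type u} [TopologicalSpace X] {n : ℕ} (F : Filtration X n) (i : ℕ)
    (x : X) : Prop :=
  ∃ (V U : Set X), IsOpen V ∧ x ∈ V ∧ x ∈ U ∧ (∃ O : Set X, IsOpen O ∧ U = F.layer i ∩ O) ∧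
    ∃ (L : Type u) (_ : TopologicalSpace L) (_ : CompactSpace L) (_ : T2Space L)
      (m : ℕ) (_ : (m : ℤ) = n - i - 1) (G : Filtration L m) (_ : G.IsFilteredSpace)
      (φ : (U × OpenCone L) ≃ₜ V),
      Filtration.IsStratifiedHomeo (G.cone.prodLeft U) (F.induced V) φ ∧
        ∀ (u : U) (l : L), (φ (u, OpenCone.apex l) : X) = u

/-- A CS set of dimension `n`: a Hausdorff filtered space whose `i`-dimensional part `Xⁱ` is a
topological `i`-manifold for each `i`, and whose singular points have conical charts. -/
structure IsCSSet {X : Type u} [TopologicalSpace X] {n : ℕ} (F : Filtration X n) : Prop where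
  t2 : T2Space X
  isFilteredSpace : F.IsFilteredSpace
  manifold : ∀ i : ℕ, Nonempty (ChartedSpace (EuclideanSpace ℝ (Fin i)) (F.layer i))
  conical : ∀ i : ℕ, i < n → ∀ x ∈ F.layer i, HasConicalChart F i x

/-- `(X, 𝒮, 𝒯)` is a CS-coarsening: both filtrations make `X` a CS set, and each stratum of `𝒯` is
a union of strata of `𝒮`. -/
structure IsCSCoarsening {X : Type u} [TopologicalSpace X] {n m : ℕ}
    (𝒮 : Filtration X n) (𝒯 : Filtration X m) : Prop where
  isCSSet_fine : IsCSSet 𝒮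
  isCSSet_coarse : IsCSSet 𝒯
  union : ∀ T : 𝒯.Stratum, ∃ A : Set 𝒮.Stratum, T.carrier = ⋃ S ∈ A, S.carrier

/-! ### Perversities -/

/-- The opposite of an extended integer: `-(-∞) = ∞`, `-(k) = -k`, `-(∞) = -∞`. -/
def extNeg (x : EInt) : EInt :=
  WithBotTop.rec (motive := fun _ => EInt) ⊤ (fun k => ((-k : ℤ) : EInt)) ⊥ x

/-- A perversity: a map from the strata to `ℤ ∪ {-∞, ∞}` which vanishes on regular strata. -/
structure Perversity {X : Type*} [TopologicalSpace X] {n : ℕ} (F : Filtration X n) where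
  toFun : F.Stratum → EInt
  regular : ∀ S : F.Stratum, S.IsRegular → toFun S = ((0 : ℤ) : EInt)

section Perversity

variable {X : Type*} [TopologicalSpace X] {n m : ℕ}

instance (F : Filtration X n) : CoeFun (Perversity F) (fun _ => F.Stratum → EInt) :=
  ⟨Perversity.toFun⟩

/-- Perversities are compared stratum by stratum. -/
instance (F : Filtration X n) : LE (Perversity F) := ⟨fun p q => ∀ S : F.Stratum, p S ≤ q S⟩

open Classical in
/-- The (integer) values of the top perversity: `codim S - 2` if `S` is singular, `0` if `S` is
regular. -/
noncomputable def topValue {F : Filtration X n} (S : F.Stratum) : ℤ :=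
  if S.IsRegular then 0 else S.codim - 2

/-- The top perversity. -/
noncomputable def topPerversity (F : Filtration X n) : Perversity F where
  toFun S := (topValue S : EInt)
  regular S h := by simp [topValue, h]

/-- The dual perversity `D p = t - p`. -/
noncomputable def Perversity.dual {F : Filtration X n} (p : Perversity F) : Perversity F where
  toFun S := (topValue S : EInt) + extNeg (p S)
  regular S h := by
    rw [p.regular S h, topValue, if_pos h]
    rfl

open Classical in
/-- The pushforward perversity along the identity of a coarsening: on a singular stratum `T` of `𝒯`
its value is the infimum of `p` over the strata of `𝒮` which lie in `T`. -/
noncomputable def Perversity.pushforward {𝒮 : Filtration X n} (p : Perversity 𝒮)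
    (𝒯 : Filtration X m) : Perversity 𝒯 where
  toFun T := if T.IsRegular then ((0 : ℤ) : EInt)
    else ⨅ (Q : 𝒮.Stratum) (_ : Q.carrier ⊆ T.carrier), p Q
  regular _ h := if_pos h

/-- The strata `S`, `Q` of `𝒮` lie in the same stratum of `𝒯`. -/
def SameCoarseStratum {𝒮 : Filtration X n} (𝒯 : Filtration X m) (S Q : 𝒮.Stratum) : Prop :=
  ∃ T : 𝒯.Stratum, S.carrier ⊆ T.carrier ∧ Q.carrier ⊆ T.carrier

/-- The conditions (K1) and (K2) defining `K`-perversities on a coarsening `(X, 𝒮, 𝒯)`. -/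
structure IsKPerversity {𝒮 : Filtration X n} (𝒯 : Filtration X m) (p : Perversity 𝒮) : Prop where
  k1_left : ∀ S Q : 𝒮.Stratum, S ≤ Q → SameCoarseStratum 𝒯 S Q → p Q ≤ p S
  k1_right : ∀ S Q : 𝒮.Stratum, S ≤ Q → SameCoarseStratum 𝒯 S Q →
    p S ≤ p Q + ((topValue S - topValue Q : ℤ) : EInt)
  k2 : ∀ S Q : 𝒮.Stratum, S.dim = Q.dim → SameCoarseStratum 𝒯 S Q → p Q = p S

end Perversity

/-! ### Polyhedral dimension and the Gajer space -/

/-- A convex polyhedron in the standard `k`-simplex: a subset cut out by finitely many affine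
inequalities. -/
def IsConvexPolyhedron {k : ℕ} (C : Set (Fin (k + 1) → ℝ)) : Prop :=
  ∃ H : Finset ((Fin (k + 1) → ℝ) →ᵃ[ℝ] ℝ),
    C = {x | x ∈ stdSimplex ℝ (Fin (k + 1)) ∧ ∀ f ∈ H, 0 ≤ f x}

/-- The subset `A` of the standard `k`-simplex is contained in a polyhedron (a finite union of
convex polyhedra) of dimension at most `ℓ`. -/
def InPolyhedron {k : ℕ} (A : Set (stdSimplex ℝ (Fin (k + 1)))) (ℓ : ℕ) : Prop :=
  ∃ 𝒞 : Set (Set (Fin (k + 1) → ℝ)), 𝒞.Finite ∧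
    (∀ C ∈ 𝒞, IsConvexPolyhedron C ∧ Module.finrank ℝ (vectorSpan ℝ C) ≤ ℓ) ∧
    Subtype.val '' A ⊆ ⋃₀ 𝒞

/-- The inequality `dim A ≤ r` for the polyhedral dimension of a subset of a simplex, i.e. the
smallest dimension of a polyhedron containing `A`; by convention `dim ∅ = -∞`. -/
def PolyDimLE {k : ℕ} (A : Set (stdSimplex ℝ (Fin (k + 1)))) (r : EInt) : Prop :=
  A = ∅ ∨ ∃ ℓ : ℕ, ((ℓ : ℤ) : EInt) ≤ r ∧ InPolyhedron A ℓ

section Gajer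

variable {X : Type u} [TopologicalSpace X] {n : ℕ} {F : Filtration X n}

/-- A singular simplex `σ : Δ → X` is `p`-allowable if
`dim σ⁻¹(S) ≤ dim Δ - D p (S) - 2` for each singular stratum `S`. -/
def IsAllowable (p : Perversity F) {k : SimplexCategoryᵒᵖ}
    (σ : (TopCat.toSSet.obj (TopCat.of X)).obj k) : Prop :=
  ∀ S : F.Stratum, S.IsSingular →
    PolyDimLE (TopCat.toSSetObjEquiv (TopCat.of X) k σ ⁻¹' S.carrier)
      ((((k.unop.len : ℤ) - 2 : ℤ) : EInt) + extNeg (p.dual S))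

/-- A singular simplex is `p`-full if each of its faces (of any dimension, itself included) is
`p`-allowable. -/
def IsFull (p : Perversity F) {k : SimplexCategoryᵒᵖ}
    (σ : (TopCat.toSSet.obj (TopCat.of X)).obj k) : Prop :=
  ∀ (j : SimplexCategory) (δ : j ⟶ k.unop), Mono δ →
    IsAllowable p ((TopCat.toSSet.obj (TopCat.of X)).map δ.op σ)

theorem finrank_le_of_map_le {V W : Type*} [AddCommGroup V] [Module ℝ V] [AddCommGroup W]
    [Module ℝ W] [FiniteDimensional ℝ V] [FiniteDimensional ℝ W] (f : V →ₗ[ℝ] W)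
    (hf : Function.Surjective f) (P : Submodule ℝ V) (Q : Submodule ℝ W) (h : P.map f ≤ Q) :
    Module.finrank ℝ P + Module.finrank ℝ W ≤ Module.finrank ℝ Q + Module.finrank ℝ V := by
  have h1 := (f.domRestrict P).finrank_range_add_finrank_ker
  have h2 := f.finrank_range_add_finrank_ker
  rw [LinearMap.range_eq_top.2 hf, finrank_top] at h2
  have h3 : Module.finrank ℝ (f.domRestrict P).range ≤ Module.finrank ℝ Q := by
    apply Submodule.finrank_mono
    rintro _ ⟨x, rfl⟩
    exact h ⟨x, x.2, rfl⟩
  have h4 : Module.finrank ℝ (f.domRestrict P).ker ≤ Module.finrank ℝ f.ker := by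
    let g : (f.domRestrict P).ker →ₗ[ℝ] f.ker :=
      (P.subtype.comp (f.domRestrict P).ker.subtype).codRestrict f.ker (fun x => x.2)
    apply LinearMap.finrank_le_finrank_of_injective (f := g)
    intro x y hxy
    have : (x : P).1 = (y : P).1 := congrArg (Subtype.val : f.ker → V) hxy
    exact Subtype.ext (Subtype.ext this)
  omega

theorem inPolyhedron_preimage {j k : ℕ} (e : Fin (j + 1) → Fin (k + 1))
    (he : Function.Surjective e) {A : Set (stdSimplex ℝ (Fin (k + 1)))} {ℓ : ℕ}
    (h : InPolyhedron A ℓ) (d : ℕ) (hd : j = k + d) :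
    InPolyhedron (stdSimplex.map (S := ℝ) e ⁻¹' A) (ℓ + d) := by
  obtain ⟨𝒞, hfin, hC, hA⟩ := h
  let f := FunOnFinite.linearMap ℝ ℝ e
  have hf : Function.Surjective f := by
    intro y
    obtain ⟨s, hs⟩ := he.hasRightInverse
    refine ⟨FunOnFinite.linearMap ℝ ℝ s y, ?_⟩
    have := FunOnFinite.linearMap_comp ℝ ℝ s e
    have h2 : e ∘ s = id := funext hs
    rw [h2, FunOnFinite.linearMap_id] at this
    exact (LinearMap.congr_fun this y).symm
  let pb : Set (Fin (k + 1) → ℝ) → Set (Fin (j + 1) → ℝ) :=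
    fun C => stdSimplex ℝ (Fin (j + 1)) ∩ f ⁻¹' C
  refine ⟨pb '' 𝒞, hfin.image _, ?_, ?_⟩
  · rintro _ ⟨C, hCm, rfl⟩
    obtain ⟨⟨H, rfl⟩, hdim⟩ := hC C hCm
    constructor
    · classical
      refine ⟨H.image fun g => g.comp f.toAffineMap, ?_⟩
      ext x
      constructor
      · rintro ⟨hx, -, hx'⟩
        refine ⟨hx, fun g hg => ?_⟩
        obtain ⟨g, hg', rfl⟩ := Finset.mem_image.1 hg
        exact hx' g hg'
      · rintro ⟨hx, hx'⟩
        refine ⟨hx, stdSimplex.image_linearMap e ⟨x, hx, rfl⟩, fun g hg => ?_⟩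
        exact hx' _ (Finset.mem_image_of_mem _ hg)
    · set C : Set (Fin (k + 1) → ℝ) :=
        {x | x ∈ stdSimplex ℝ (Fin (k + 1)) ∧ ∀ f ∈ H, 0 ≤ f x}
      have hle : (vectorSpan ℝ (pb C)).map f ≤ vectorSpan ℝ C := by
        rw [vectorSpan_def, Submodule.map_span, Submodule.span_le]
        rintro _ ⟨_, ⟨a, ha, b, hb, rfl⟩, rfl⟩
        have hab : f (a -ᵥ b) = f a -ᵥ f b := map_sub f a b
        rw [hab]
        exact vsub_mem_vectorSpan ℝ ha.2 hb.2
      have := finrank_le_of_map_le f hf _ _ hle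
      simp only [Module.finrank_fin_fun] at this
      omega
  · rintro _ ⟨x, hx, rfl⟩
    obtain ⟨C, hCm, hxC⟩ := hA ⟨_, hx, rfl⟩
    exact ⟨pb C, ⟨C, hCm, rfl⟩, x.2, hxC⟩

theorem IsAllowable.degenerate {p : Perversity F} {j k : SimplexCategory} (e : j ⟶ k) [Epi e]
    {σ : (TopCat.toSSet.obj (TopCat.of X)).obj (op k)} (hσ : IsAllowable p σ) :
    IsAllowable p ((TopCat.toSSet.obj (TopCat.of X)).map e.op σ) := by
  intro S hS
  have hpre : TopCat.toSSetObjEquiv (TopCat.of X) (op j)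
      ((TopCat.toSSet.obj (TopCat.of X)).map e.op σ) ⁻¹' S.carrier =
      stdSimplex.map (S := ℝ) e ⁻¹'
        (TopCat.toSSetObjEquiv (TopCat.of X) (op k) σ ⁻¹' S.carrier) := rfl
  rw [hpre]
  rcases hσ S hS with h | ⟨ℓ, hr, h⟩
  · left
    rw [h, Set.preimage_empty]
  · right
    obtain ⟨d, hd⟩ := Nat.exists_eq_add_of_le (SimplexCategory.len_le_of_epi e)
    refine ⟨ℓ + d, ?_, inPolyhedron_preimage _ (SimplexCategory.epi_iff_surjective.1 inferInstance)
      h d hd⟩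
    revert hr
    generalize extNeg (p.dual S) = y
    simp only [hd]
    induction y using WithBotTop.rec with
    | bot => simp
    | coe a =>
      intro hr
      have hr' : (ℓ : ℤ) ≤ (k.len : ℤ) - 2 + a := WithBotTop.coe_le_coe.1 hr
      refine WithBotTop.coe_le_coe.2 (?_ : _ ≤ ((k.len + d : ℕ) : ℤ) - 2 + a)
      push_cast
      omega
    | top => exact fun _ => le_top

variable (F) in
/-- The Gajer space of `(X, F, p)`: the simplicial set of `p`-full singular simplices. -/
def gajerSpace (p : Perversity F) : (TopCat.toSSet.obj (TopCat.of X)).Subcomplex where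
  obj _ := {σ | IsFull p σ}
  map {U V} i σ hσ := by
    intro j δ _
    have key : (TopCat.toSSet.obj (TopCat.of X)).map δ.op
        ((TopCat.toSSet.obj (TopCat.of X)).map i σ) =
        (TopCat.toSSet.obj (TopCat.of X)).map (Limits.factorThruImage (δ ≫ i.unop)).op
          ((TopCat.toSSet.obj (TopCat.of X)).map (Limits.image.ι (δ ≫ i.unop)).op σ) := by
      rw [← Functor.map_comp_apply, ← Functor.map_comp_apply, ← op_comp, Limits.image.fac, op_comp,
        Quiver.Hom.op_unop]
    rw [key]
    exact (hσ _ (Limits.image.ι (δ ≫ i.unop)) inferInstance).degenerate _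

/-- The set `π₀ᵖ(X, F)` of connected components of the Gajer space. -/
abbrev intersectionπ₀ (p : Perversity F) : Type u := SSet.π₀ (gajerSpace F p : SSet.{u})

end Gajer

end CSCoarsening

/-! Since `p ≤ t`, the bound `dim Δ - 2 - D p (S)` is negative on singular strata when `dim Δ ≤ 1`,
so full vertices and edges lie in the regular part; conversely every simplex in the regular part is
full. Hence `π₀` of the Gajer space is the set of path components of the regular part
(`π₀_mk_eq_mk_iff`). The pushforward is also bounded by the top perversity, so the same holds for
`𝒯`, and it remains to compare the two regular parts.

Surjectivity: `𝒮`-regular points are dense and the `𝒯`-regular part is locally path connected.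
Injectivity: a regular stratum of `𝒯` is a connected open manifold, and its `𝒮`-singular points have
codimension at least two, because (K1) against a regular stratum gives `0 ≤ codim S - 2`
(`level_add_one_ne`). Such layers do not disconnect it: their links are connected
(`preconnectedSpace_link`). Otherwise, giving the cone radius opposite signs on two clopen pieces of
the link would produce a map from a piece of `ℝⁿ` to `ℝⁱ⁺¹`, with `i + 1 < n`, having a one-point
zero fibre and a local section. A Brouwer argument excludes this (`le_of_isolated_zero`); it also
yields the invariance of dimension.

For the inclusion of Gajer spaces, a simplex meets finitely many strata by compactness and local
finiteness. So the preimage of `T` is a finite union of preimages of strata `S ⊆ T`, and (K1) bounds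
each by comparison with a stratum of `𝒮` in `T` of full dimension, whose closure contains `S`
(`exists_le_of_subset`). -/

namespace CSCoarsening
open Metric MeasureTheory Set Topology

/-! ### Brouwer's theorem and a dimension inequality in Euclidean spaces. -/

section Brouwer

/-- Euclidean space of dimension `d`. -/
abbrev Euc (d : ℕ) : Type := EuclideanSpace ℝ (Fin d)

variable {d : ℕ}

/-- The determinant of `1 + t A` is a polynomial of degree at most `d` in `t`. -/
theorem exists_polynomial_det_one_add_smul (A : Euc d →L[ℝ] Euc d) :
    ∃ P : Polynomial ℝ, P.natDegree ≤ d ∧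
      ∀ t : ℝ, P.eval t = (1 + t • A : Euc d →L[ℝ] Euc d).det := by
  let b := (EuclideanSpace.basisFun (Fin d) ℝ).toBasis
  let M := LinearMap.toMatrix b b (A : Euc d →ₗ[ℝ] Euc d)
  refine ⟨Matrix.det ((Polynomial.X : Polynomial ℝ) • M.map Polynomial.C +
    (1 : Matrix (Fin d) (Fin d) ℝ).map Polynomial.C), ?_, fun t => ?_⟩
  · simpa using Polynomial.natDegree_det_X_add_C_le M 1
  · have h1 : (1 + t • A : Euc d →L[ℝ] Euc d).det = Matrix.det (1 + t • M) := by
      rw [ContinuousLinearMap.det, ← LinearMap.det_toMatrix b]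
      congr 1
      have : ((1 + t • A : Euc d →L[ℝ] Euc d) : Euc d →ₗ[ℝ] Euc d) =
        LinearMap.id + t • (A : Euc d →ₗ[ℝ] Euc d) := rfl
      rw [this, map_add, map_smul, LinearMap.toMatrix_id]
    rw [h1, ← Polynomial.coe_evalRingHom, RingHom.map_det]
    congr 1
    ext i j
    simp only [Matrix.one_apply, Polynomial.coe_evalRingHom, RingHom.mapMatrix_apply,
      Matrix.map_apply, Matrix.add_apply, Matrix.smul_apply, smul_eq_mul, Polynomial.eval_add,
      Polynomial.eval_mul, Polynomial.eval_X, Polynomial.eval_C]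
    ring

/-- Small perturbations of the identity have positive determinant. -/
theorem det_one_add_smul_pos (A : Euc d →L[ℝ] Euc d) {t : ℝ} (ht : 0 ≤ t) (h : t * ‖A‖ < 1) :
    0 < (1 + t • A : Euc d →L[ℝ] Euc d).det := by
  -- The Neumann series makes `1 + s A` invertible along the whole segment, so the determinant
  -- cannot change sign from its value `1` at `s = 0`.
  have hne : ∀ s ∈ Icc 0 t, (1 + s • A : Euc d →L[ℝ] Euc d).det ≠ 0 := by
    intro s hs
    have hlt : ‖-(s • A)‖ < 1 := by
      rw [norm_neg, norm_smul, Real.norm_of_nonneg hs.1]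
      exact (mul_le_mul_of_nonneg_right hs.2 (norm_nonneg _)).trans_lt h
    have hu : IsUnit (1 + s • A : Euc d →L[ℝ] Euc d) := by
      simpa using isUnit_one_sub_of_norm_lt_one hlt
    have := (hu.map (ContinuousLinearMap.toLinearMapRingHom (R₁ := ℝ) (M₁ := Euc d))).map
      (LinearMap.det : (Euc d →ₗ[ℝ] Euc d) →* ℝ)
    exact this.ne_zero
  by_contra hneg
  push Not at hneg
  have hcont : ContinuousOn (fun s : ℝ => (1 + s • A : Euc d →L[ℝ] Euc d).det) (Icc 0 t) :=
    (ContinuousLinearMap.continuous_det.comp (by fun_prop)).continuousOn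
  have := intermediate_value_Icc' ht hcont
  obtain ⟨s, hs, hs0⟩ := this ⟨hneg, by simp [ContinuousLinearMap.det]⟩
  exact hne s hs hs0

/-- There is no `C¹` retraction of a closed ball onto its boundary. -/
theorem not_retraction {δ : ℝ} (hδ : 0 < δ) {r : Euc d → Euc d} (hr : ContDiff ℝ 1 r)
    (hnorm : ∀ x, ‖r x‖ = δ) (hid : ∀ x, ‖x‖ = δ → r x = x) : False := by
  -- Milnor–Rogers argument: for small `t` the map `x + t u(x)` is a bijection of the ball, so the
  -- integral of its Jacobian is the volume of the ball. That integral is polynomial in `t`, so the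
  -- equality persists at `t = 1`, where the map is `r` and its Jacobian vanishes.
  set u : Euc d → Euc d := fun x => r x - x with hu
  have huC : ContDiff ℝ 1 u := hr.sub contDiff_id
  obtain ⟨C, hC⟩ := huC.contDiffOn.exists_lipschitzOnWith one_ne_zero
    (convex_closedBall (0 : Euc d) δ) (isCompact_closedBall _ _)
  have hdiff : ∀ x, HasStrictFDerivAt u (fderiv ℝ u x) x := fun x =>
    huC.contDiffAt.hasStrictFDerivAt one_ne_zero
  have hball : MeasurableSet (ball (0 : Euc d) δ) := measurableSet_ball
  have hfc : Continuous (fderiv ℝ u) := huC.continuous_fderiv one_ne_zero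
  have hint : ∀ t : ℝ, IntegrableOn
      (fun x => (1 + t • fderiv ℝ u x : Euc d →L[ℝ] Euc d).det) (ball (0 : Euc d) δ) := by
    intro t
    have hc : Continuous fun x => (1 + t • fderiv ℝ u x : Euc d →L[ℝ] Euc d).det :=
      ContinuousLinearMap.continuous_det.comp (by fun_prop)
    exact (hc.continuousOn.integrableOn_compact (isCompact_closedBall _ _)).mono_set
      ball_subset_closedBall
  have hsmall : ∀ t : ℝ, 0 ≤ t → t < 1 → t * C < 1 →
      ∫ x in ball (0 : Euc d) δ, (1 + t • fderiv ℝ u x : Euc d →L[ℝ] Euc d).det =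
        volume.real (ball (0 : Euc d) δ) := by
    intro t ht0 ht1 htC
    set h : Euc d → Euc d := fun x => x + t • u x with hh
    have hh' : ∀ x, HasStrictFDerivAt h (1 + t • fderiv ℝ u x : Euc d →L[ℝ] Euc d) x := fun x =>
      (hasStrictFDerivAt_id x).add ((hdiff x).const_smul t)
    have hpos : ∀ x ∈ ball (0 : Euc d) δ,
        0 < (1 + t • fderiv ℝ u x : Euc d →L[ℝ] Euc d).det := by
      intro x hx
      refine det_one_add_smul_pos _ ht0 (lt_of_le_of_lt ?_ htC)
      exact mul_le_mul_of_nonneg_left (norm_fderiv_le_of_lipschitzOn ℝ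
        (Filter.mem_of_superset (isOpen_ball.mem_nhds hx) ball_subset_closedBall) hC) ht0
    have hinj : InjOn h (closedBall (0 : Euc d) δ) := by
      intro x hx y hy hxy
      by_contra hne
      have h1 : x - y = -(t • (u x - u y)) := by
        have : x + t • u x = y + t • u y := hxy
        rw [eq_neg_iff_add_eq_zero, smul_sub, ← sub_eq_zero.2 this]
        abel
      have h2 : ‖x - y‖ ≤ t * (C * ‖x - y‖) := by
        conv_lhs => rw [h1, norm_neg, norm_smul, Real.norm_of_nonneg ht0]
        exact mul_le_mul_of_nonneg_left (by simpa [dist_eq_norm] using hC.dist_le_mul x hx y hy) ht0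
      have h3 : 0 < ‖x - y‖ := norm_pos_iff.2 (sub_ne_zero.2 hne)
      nlinarith
    -- The image is open by the inverse function theorem and relatively closed in the connected
    -- ball, since boundary points are fixed by `h`.
    have himg : h '' ball (0 : Euc d) δ = ball (0 : Euc d) δ := by
      have hsub : h '' ball (0 : Euc d) δ ⊆ ball (0 : Euc d) δ := by
        rintro _ ⟨x, hx, rfl⟩
        rw [mem_ball_zero_iff] at hx ⊢
        have : h x = (1 - t) • x + t • r x := by
          simp only [hh, hu, smul_sub, sub_smul, one_smul]; abel
        rw [this]
        calc ‖(1 - t) • x + t • r x‖ ≤ (1 - t) * ‖x‖ + t * δ := by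
              refine (norm_add_le _ _).trans ?_
              rw [norm_smul, norm_smul, hnorm, Real.norm_of_nonneg ht0,
                Real.norm_of_nonneg (by linarith)]
          _ < δ := by nlinarith
      refine subset_antisymm hsub ?_
      refine (convex_ball (0 : Euc d) δ).isPreconnected.subset_of_closure_inter_subset ?_ ?_ ?_
      · rw [isOpen_iff_mem_nhds]
        rintro _ ⟨x, hx, rfl⟩
        have hdet := (hpos x hx).ne'
        have hs := hh' x
        rw [← hs.map_nhds_eq_of_equiv
          (f' := ContinuousLinearMap.toContinuousLinearEquivOfDetNeZero _ hdet)]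
        exact Filter.image_mem_map (isOpen_ball.mem_nhds hx)
      · refine ⟨h 0, hsub ⟨0, by simpa using hδ, rfl⟩, ⟨0, by simpa using hδ, rfl⟩⟩
      · rintro y ⟨hy, hyb⟩
        have hcont : Continuous h := by
          have := huC.continuous
          fun_prop
        have hcl : closure (h '' ball (0 : Euc d) δ) ⊆ h '' closedBall (0 : Euc d) δ :=
          closure_minimal (image_mono ball_subset_closedBall)
            ((isCompact_closedBall _ _).image hcont).isClosed
        obtain ⟨x, hx, rfl⟩ := hcl hy
        rcases (mem_closedBall_zero_iff.1 hx).lt_or_eq with hlt | heq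
        · exact ⟨x, mem_ball_zero_iff.2 hlt, rfl⟩
        · have : h x = x := by simp [hh, hu, hid x heq]
          rw [this, mem_ball_zero_iff] at hyb
          exact absurd heq hyb.ne
    have hcv := integral_image_eq_integral_abs_det_fderiv_smul (volume : Measure (Euc d)) hball
      (fun x _ => (hh' x).hasFDerivAt.hasFDerivWithinAt) (hinj.mono ball_subset_closedBall)
      (fun _ => (1 : ℝ))
    rw [himg] at hcv
    simp only [smul_eq_mul, mul_one, integral_const, MeasurableSet.univ, measureReal_restrict_apply,
      univ_inter] at hcv
    rw [hcv]
    exact setIntegral_congr_fun hball fun x hx => (abs_of_pos (hpos x hx)).symm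
  -- interpolation at `d + 1` small parameters
  let v : ℕ → ℝ := fun i => 1 / ((i + 2) * (C + 1))
  have hC0 : (0 : ℝ) ≤ C := C.2
  have hv0 : ∀ i, 0 < v i := fun i => by positivity
  have hv1 : ∀ i, v i < 1 := fun i => by
    rw [div_lt_one (by positivity)]
    have : (0 : ℝ) ≤ i := Nat.cast_nonneg i
    nlinarith
  have hvC : ∀ i, v i * C < 1 := fun i => by
    rw [div_mul_eq_mul_div, div_lt_one (by positivity)]
    have : (0 : ℝ) ≤ i := Nat.cast_nonneg i
    nlinarith
  have hvinj : Function.Injective v := by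
    intro i j hij
    have h1 : ((i : ℝ) + 2) * (C + 1) = (j + 2) * (C + 1) := by
      simpa [v] using hij
    have h2 := mul_right_cancel₀ (by positivity : (C : ℝ) + 1 ≠ 0) h1
    exact_mod_cast (add_right_cancel h2)
  have hvI : InjOn v (Finset.range (d + 1)) := hvinj.injOn
  let ℓ : ℕ → ℝ := fun i => (Lagrange.basis (Finset.range (d + 1)) v i).eval 1
  have hℓ : ∑ i ∈ Finset.range (d + 1), ℓ i = 1 := by
    have := Lagrange.sum_basis hvI (by simp)
    rw [← Polynomial.eval_finsetSum, this, Polynomial.eval_one]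
  have hdet : ∀ x, (1 + (1 : ℝ) • fderiv ℝ u x : Euc d →L[ℝ] Euc d).det =
      ∑ i ∈ Finset.range (d + 1),
        (1 + v i • fderiv ℝ u x : Euc d →L[ℝ] Euc d).det * ℓ i := by
    intro x
    obtain ⟨P, hP, hPe⟩ := exists_polynomial_det_one_add_smul (fderiv ℝ u x)
    rw [← hPe 1]
    have hdeg : P.degree < (Finset.range (d + 1)).card := by
      rw [Finset.card_range]
      exact (Polynomial.degree_le_of_natDegree_le hP).trans_lt (by exact_mod_cast Nat.lt_succ_self d)
    conv_lhs => rw [Lagrange.eq_interpolate hvI hdeg, Lagrange.interpolate_apply,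
      Polynomial.eval_finsetSum]
    refine Finset.sum_congr rfl fun i _ => ?_
    rw [Polynomial.eval_mul, Polynomial.eval_C, hPe]
  have hone : ∫ x in ball (0 : Euc d) δ, (1 + (1 : ℝ) • fderiv ℝ u x : Euc d →L[ℝ] Euc d).det =
      volume.real (ball (0 : Euc d) δ) := by
    simp_rw [hdet]
    rw [integral_finsetSum _ fun i _ => (hint (v i)).mul_const _]
    simp_rw [integral_mul_const, hsmall _ (hv0 _).le (hv1 _) (hvC _)]
    rw [← Finset.mul_sum, hℓ, mul_one]
  -- `‖r‖²` is constant, so `r x ≠ 0` is orthogonal to the range of the derivative, which therefore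
  -- cannot be invertible.
  have hzero : ∀ x, (1 + (1 : ℝ) • fderiv ℝ u x : Euc d →L[ℝ] Euc d).det = 0 := by
    intro x
    have hrd : HasFDerivAt r (fderiv ℝ r x) x := (hr.differentiable one_ne_zero x).hasFDerivAt
    have h1 : (1 + (1 : ℝ) • fderiv ℝ u x : Euc d →L[ℝ] Euc d) = fderiv ℝ r x := by
      have : fderiv ℝ u x = fderiv ℝ r x - 1 := (hrd.sub (hasFDerivAt_id x)).fderiv
      rw [this, one_smul]; abel
    rw [h1]
    by_contra hne
    let e := ContinuousLinearMap.toContinuousLinearEquivOfDetNeZero _ hne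
    have h2 : HasFDerivAt (fun y => inner ℝ (r y) (r y)) _ x := hrd.inner ℝ hrd
    have h3 : (fun y => inner ℝ (r y) (r y)) = fun _ => δ ^ 2 := by
      ext y
      rw [real_inner_self_eq_norm_sq, hnorm]
    rw [h3] at h2
    have h4 := h2.unique (hasFDerivAt_const (δ ^ 2) x)
    have h5 := congrArg (fun L : (Euc d) →L[ℝ] ℝ => L (e.symm (r x))) h4
    have h6 : fderiv ℝ r x (e.symm (r x)) = r x := e.apply_symm_apply (r x)
    simp [fderivInnerCLM_apply, h6, hnorm] at h5
    exact hδ.ne' h5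
  simp_rw [hzero, integral_zero] at hone
  exact (measureReal_ne_zero_iff measure_ball_lt_top.ne).2 (measure_ball_pos volume _ hδ).ne'
    hone.symm

/-- A continuous map on a closed set is uniformly approximated by a `C¹` map. -/
theorem exists_contDiff_approx {n : ℕ} {K : Set (Euc d)} (hK : IsClosed K)
    {q : Euc d → Euc n} (hq : ContinuousOn q K)
    {ε : ℝ} (hε : 0 < ε) :
    ∃ g : Euc d → Euc n, ContDiff ℝ 1 g ∧
      ∀ x ∈ K, dist (g x) (q x) < ε := by
  -- The constraint is vacuous off `K`. On convex constraints, locally constant solutions glue by a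
  -- smooth partition of unity.
  have hconv : ∀ x, Convex ℝ {y : Euc n | x ∈ K → dist y (q x) < ε} := by
    intro x
    by_cases hx : x ∈ K
    · simpa [hx, ball] using convex_ball (q x) ε
    · simpa [hx] using convex_univ
  have hloc : ∀ x, ∃ c, ∀ᶠ y in 𝓝 x,
      c ∈ {z : Euc n | y ∈ K → dist z (q y) < ε} := by
    intro x
    refine ⟨q x, ?_⟩
    by_cases hx : x ∈ K
    · have := (hq x hx).eventually (ball_mem_nhds (q x) hε)
      filter_upwards [eventually_nhdsWithin_iff.1 this] with y hy hyK
      rw [dist_comm]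
      exact hy hyK
    · filter_upwards [hK.isOpen_compl.mem_nhds hx] with y hy hyK
      exact absurd hyK hy
  obtain ⟨g, hg⟩ := exists_contMDiffMap_forall_mem_convex_of_local_const
    (n := 1) (modelWithCornersSelf ℝ (Euc d)) hconv hloc
  exact ⟨g, g.contMDiff.contDiff, hg⟩

/-- A form of Brouwer's theorem: a continuous map on a closed ball which is close to the identity
has a zero. -/
theorem exists_zero_of_close_to_id {δ : ℝ} (hδ : 0 < δ)
    {q : Euc d → Euc d}
    (hq : ContinuousOn q (closedBall 0 δ)) (hqid : ∀ x ∈ closedBall 0 δ, dist (q x) x ≤ δ / 4) :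
    ∃ x ∈ closedBall 0 δ, q x = 0 := by
  by_contra! hne
  obtain ⟨c, hc0, hc⟩ : ∃ c > 0, ∀ x ∈ closedBall (0 : Euc d) δ,
      c ≤ ‖q x‖ := by
    obtain ⟨x, hx, hmin⟩ := (isCompact_closedBall (0 : Euc d) δ).exists_isMinOn
      ⟨0, mem_closedBall_self hδ.le⟩ hq.norm
    exact ⟨‖q x‖, norm_pos_iff.2 (hne x hx), fun y hy => hmin hy⟩
  obtain ⟨g, hgC, hg⟩ := exists_contDiff_approx isClosed_closedBall hq
    (lt_min hc0 (by positivity : 0 < δ / 4))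
  have hg0 : ∀ x ∈ closedBall (0 : Euc d) δ, g x ≠ 0 := by
    intro x hx h0
    have h1 := (hg x hx).trans_le (min_le_left _ _)
    rw [h0, dist_zero_left] at h1
    exact absurd (hc x hx) h1.not_ge
  have hgid : ∀ x ∈ closedBall (0 : Euc d) δ, ‖g x - x‖ < δ / 2 := by
    intro x hx
    have h1 := (hg x hx).trans_le (min_le_right _ _)
    rw [← dist_eq_norm]
    linarith [dist_triangle (g x) (q x) x, hqid x hx]
  -- `Q` equals `g` on the half ball and the identity outside the ball. In between, `‖g x - x‖ < δ /
  -- 2 ≤ ‖x‖` rules out zeros, so `Q` normalised to length `δ` is a forbidden retraction.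
  let χ : ContDiffBump (0 : Euc d) := ⟨δ / 2, δ, by positivity, by linarith⟩
  let Q : Euc d → Euc d := fun x => x + χ x • (g x - x)
  have hQC : ContDiff ℝ 1 Q := contDiff_id.add (χ.contDiff.smul (hgC.sub contDiff_id))
  have hQid : ∀ x, δ ≤ ‖x‖ → Q x = x := by
    intro x hx
    have : χ x = 0 := χ.zero_of_le_dist (by simpa using hx)
    simp [Q, this]
  have hQ0 : ∀ x, Q x ≠ 0 := by
    intro x h0
    rcases le_total δ ‖x‖ with h | h
    · rw [hQid x h] at h0
      rw [h0, norm_zero] at h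
      linarith
    · have hx : x ∈ closedBall (0 : Euc d) δ := by simpa using h
      rcases le_total ‖x‖ (δ / 2) with h' | h'
      · have : χ x = 1 := χ.one_of_mem_closedBall (by simpa [χ] using h')
        simp only [Q, this, one_smul, add_sub_cancel] at h0
        exact hg0 x hx h0
      · have h1 : x = -(χ x • (g x - x)) := eq_neg_of_add_eq_zero_left h0
        have h2 : ‖x‖ ≤ 1 * ‖g x - x‖ := by
          conv_lhs => rw [h1, norm_neg, norm_smul, Real.norm_of_nonneg χ.nonneg]
          exact mul_le_mul_of_nonneg_right χ.le_one (norm_nonneg _)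
        linarith [hgid x hx]
  refine not_retraction hδ (r := fun x => (δ * ‖Q x‖⁻¹) • Q x) ?_ ?_ ?_
  · exact (contDiff_const.mul ((hQC.norm ℝ hQ0).inv fun x => norm_ne_zero_iff.2 (hQ0 x))).smul hQC
  · intro x
    have := norm_ne_zero_iff.2 (hQ0 x)
    rw [norm_smul, norm_mul, norm_inv, norm_norm, mul_assoc, inv_mul_cancel₀ this, mul_one,
      Real.norm_of_nonneg hδ.le]
  · intro x hx
    simp only [hQid x hx.ge, hx, mul_inv_cancel₀ hδ.ne', one_smul]

/-- A neighbourhood in `ℝⁿ` which retracts onto a `d`-dimensional one, with a fibre consisting of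
one point, exists only if `n ≤ d`. -/
theorem le_of_isolated_zero {n : ℕ} {z : Euc n}
    {W : Set (Euc n)} (hW : W ∈ 𝓝 z)
    {f : Euc n → Euc d} (hf : ContinuousOn f W)
    (hf0 : ∀ x ∈ W, f x = 0 → x = z)
    {s : Euc d → Euc n}
    (hs : ∀ᶠ y in 𝓝 0, ContinuousAt s y ∧ f (s y) = y) (hs0 : s 0 = z) : n ≤ d := by
  by_contra! hlt
  obtain ⟨ρ, hρ, hρW⟩ := nhds_basis_closedBall.mem_iff.1 hW
  have hs1 : ∀ᶠ y in 𝓝 0, s y ∈ ball z (ρ / 2) := by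
    have := hs.self_of_nhds.1
    rw [ContinuousAt, hs0] at this
    exact this.eventually (ball_mem_nhds z (by positivity))
  obtain ⟨δ, hδ, hδs⟩ := nhds_basis_closedBall.eventually_iff.1 (hs.and hs1)
  have huc := (isCompact_closedBall z ρ).uniformContinuousOn_of_continuous (hf.mono hρW)
  obtain ⟨η, hη, hηf⟩ := Metric.uniformContinuousOn_iff.1 huc (δ / 4) (by positivity)
  set η' := min η (ρ / 2) with hη'
  have hη'0 : 0 < η' := lt_min hη (by positivity)
  -- As `d < n`, the range of a `C¹` approximation of `s` has dense complement, so a small translate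
  -- `h` of it misses `z`. But `f ∘ h` stays close to the identity and so has a zero, which can only
  -- be sent to `z` by `h`.
  obtain ⟨g, hgC, hg⟩ := exists_contDiff_approx isClosed_closedBall
    (fun y hy => (hδs hy).1.1.continuousWithinAt : ContinuousOn s (closedBall 0 δ))
    (half_pos hη'0)
  obtain ⟨w, hw, hwz⟩ : ∃ w, w ∉ range g ∧ dist w z < η' / 2 := by
    have := hgC.dense_compl_range_of_finrank_lt_finrank (by simpa using hlt)
    obtain ⟨w, hw, hw'⟩ := Metric.dense_iff.1 this z (η' / 2) (half_pos hη'0)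
    exact ⟨w, hw', hw⟩
  set h : Euc d → Euc n := fun x => g x - (w - z) with hh
  have hhs : ∀ x ∈ closedBall (0 : Euc d) δ, dist (h x) (s x) < η' := by
    intro x hx
    have h1 : dist (h x) (g x) = dist w z := by
      rw [dist_eq_norm, dist_eq_norm, ← norm_neg (w - z)]
      congr 1
      simp only [hh]; abel
    linarith [dist_triangle (h x) (g x) (s x), hg x hx]
  have hhρ : ∀ x ∈ closedBall (0 : Euc d) δ, h x ∈ closedBall z ρ := by
    intro x hx
    have h1 : dist (s x) z < ρ / 2 := (hδs hx).2
    have h2 := (hhs x hx).trans_le (min_le_right _ _)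
    rw [mem_closedBall]
    linarith [dist_triangle (h x) (s x) z]
  have hcont : ContinuousOn (fun x => f (h x)) (closedBall 0 δ) :=
    (hf.mono hρW).comp (hgC.continuous.sub continuous_const).continuousOn hhρ
  obtain ⟨x, hx, hx0⟩ := exists_zero_of_close_to_id hδ hcont fun x hx => by
    have h1 : s x ∈ closedBall z ρ := by
      have : dist (s x) z < ρ / 2 := (hδs hx).2
      rw [mem_closedBall]
      linarith
    have h2 := hηf (h x) (hhρ x hx) (s x) h1 ((hhs x hx).trans_le (min_le_left _ _))
    rw [(hδs hx).1.2] at h2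
    exact h2.le
  have h1 : g x - (w - z) = z := hf0 _ (hρW (hhρ x hx)) hx0
  exact hw ⟨x, by rw [sub_eq_iff_eq_add] at h1; rw [h1]; abel⟩

end Brouwer

/-! ### Local coordinates and invariance of dimension. -/

section LocallyEuclidean

variable {X : Type*} [TopologicalSpace X]

/-- Local coordinates around a point of a locally Euclidean subspace. -/
theorem exists_local_coordinates {n : ℕ} (Y : Set X)
    (hY : Nonempty (ChartedSpace (EuclideanSpace ℝ (Fin n)) Y)) {z : X} (hz : z ∈ Y) :
    ∃ (N : Set X) (ψ : X → EuclideanSpace ℝ (Fin n)) (θ : EuclideanSpace ℝ (Fin n) → X),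
      N ⊆ Y ∧ N ∈ 𝓝[Y] z ∧ ContinuousOn ψ N ∧ ψ z = 0 ∧ θ 0 = z ∧ (∀ x ∈ N, θ (ψ x) = x) ∧
      ∀ᶠ v in 𝓝 0, ContinuousAt θ v ∧ θ v ∈ N ∧ ψ (θ v) = v := by
  classical
  obtain ⟨_⟩ := hY
  let c := chartAt (EuclideanSpace ℝ (Fin n)) (⟨z, hz⟩ : Y)
  set c₀ := c ⟨z, hz⟩ with hc₀
  have hzc : (⟨z, hz⟩ : Y) ∈ c.source := mem_chart_source _ _
  -- The value `0` off `Y` is a default: the conclusions concern `ψ` only on `N ⊆ Y`.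
  let ψ : X → EuclideanSpace ℝ (Fin n) := fun x => if h : x ∈ Y then c ⟨x, h⟩ - c₀ else 0
  have hψ : ∀ y : Y, ψ y = c y - c₀ := fun y => by simp [ψ]
  refine ⟨(↑) '' c.source, ψ, fun v => (c.symm (v + c₀) : X), ?_, ?_, ?_, ?_, ?_, ?_, ?_⟩
  · rintro _ ⟨y, -, rfl⟩
    exact y.2
  · rw [← map_nhds_subtype_val ⟨z, hz⟩]
    exact Filter.image_mem_map (c.open_source.mem_nhds hzc)
  · rw [IsInducing.subtypeVal.continuousOn_image_iff]
    exact (c.continuousOn.sub continuousOn_const).congr fun y _ => hψ y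
  · simp [ψ, hz, hc₀]
  · simp [hc₀, c.left_inv hzc]
  · rintro _ ⟨y, hy, rfl⟩
    simp [hψ, c.left_inv hy]
  · have : ∀ᶠ v in 𝓝 (0 : EuclideanSpace ℝ (Fin n)), v + c₀ ∈ c.target := by
      have hcont : Filter.Tendsto (fun v => v + c₀) (𝓝 (0 : EuclideanSpace ℝ (Fin n)))
          (𝓝 (0 + c₀)) := (continuous_id.add continuous_const).continuousAt
      rw [zero_add] at hcont
      exact hcont.eventually (c.open_target.mem_nhds (c.map_source hzc))
    filter_upwards [this] with v hv
    refine ⟨?_, ⟨_, c.map_target hv, rfl⟩, ?_⟩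
    · have h1 : ContinuousAt c.symm (v + c₀) := c.continuousAt_symm hv
      exact continuous_subtype_val.continuousAt.comp
        (ContinuousAt.comp (f := fun v => v + c₀) h1 (by fun_prop))
    · simp [hψ, c.right_inv hv]

/-- Local coordinates of `Y` at `z` reduce this to `le_of_isolated_zero`, applied to `f ∘ θ` and `ψ
∘ s`. -/
theorem le_of_isolated_zero_of_locallyEuclidean {n d : ℕ} {Y : Set X}
    (hY : Nonempty (ChartedSpace (EuclideanSpace ℝ (Fin n)) Y)) {z : X} (hz : z ∈ Y)
    {W : Set X} (hW : W ∈ 𝓝[Y] z) {f : X → EuclideanSpace ℝ (Fin d)} (hf : ContinuousOn f W)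
    (hf0 : ∀ x ∈ W, f x = 0 → x = z) {s : EuclideanSpace ℝ (Fin d) → X}
    (hs : ∀ᶠ y in 𝓝 0, ContinuousAt s y ∧ s y ∈ Y ∧ f (s y) = y) (hs0 : s 0 = z) : n ≤ d := by
  obtain ⟨N, ψ, θ, hNY, hN, hψ, hψz, hθ0, hθψ, hθ⟩ := exists_local_coordinates Y hY hz
  have hθt : Filter.Tendsto θ (𝓝 0) (𝓝[Y] z) := by
    rw [tendsto_nhdsWithin_iff]
    refine ⟨?_, hθ.mono fun v hv => hNY hv.2.1⟩
    have := hθ.self_of_nhds.1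
    rwa [ContinuousAt, hθ0] at this
  have hst : Filter.Tendsto s (𝓝 0) (𝓝[Y] z) := by
    rw [tendsto_nhdsWithin_iff]
    refine ⟨?_, hs.mono fun v hv => hv.2.1⟩
    have := hs.self_of_nhds.1
    rwa [ContinuousAt, hs0] at this
  refine le_of_isolated_zero (z := 0) (f := f ∘ θ) (s := ψ ∘ s)
    (W := {v | (ContinuousAt θ v ∧ θ v ∈ N ∧ ψ (θ v) = v) ∧ θ v ∈ W}) ?_ ?_ ?_ ?_ ?_
  · exact hθ.and (hθt.eventually hW)
  · exact hf.comp (fun v hv => hv.1.1.continuousWithinAt) fun v hv => hv.2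
  · intro v hv h0
    rw [← hv.1.2.2, hf0 _ hv.2 h0, hψz]
  · have hsN : ∀ᶠ y in 𝓝 0, s y ∈ N := hst.eventually hN
    filter_upwards [hs, hsN.eventually_nhds] with y hy hyN
    refine ⟨?_, ?_⟩
    · have h1 : Filter.Tendsto s (𝓝 y) (𝓝[N] (s y)) :=
        tendsto_nhdsWithin_iff.2 ⟨hy.1, hyN⟩
      exact (hψ (s y) hyN.self_of_nhds).tendsto.comp h1
    · simp [hθψ _ hyN.self_of_nhds, hy.2.2]
  · simp [hs0, hψz]

/-- Invariance of dimension for subspaces with the same germ at a point. -/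
theorem dim_eq_of_nhdsWithin_eq {k j : ℕ} {Y₁ Y₂ : Set X}
    (h₁ : Nonempty (ChartedSpace (EuclideanSpace ℝ (Fin k)) Y₁))
    (h₂ : Nonempty (ChartedSpace (EuclideanSpace ℝ (Fin j)) Y₂)) {z : X} (hz₁ : z ∈ Y₁)
    (hz₂ : z ∈ Y₂) (h : 𝓝[Y₁] z = 𝓝[Y₂] z) : k = j := by
  -- A chart of `Y₁` serves as the map on `Y₂`: its zero fibre is one point and its inverse is a
  -- section.
  have key : ∀ {k j : ℕ} {Y₁ Y₂ : Set X}
      (_ : Nonempty (ChartedSpace (EuclideanSpace ℝ (Fin k)) Y₁))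
      (_ : Nonempty (ChartedSpace (EuclideanSpace ℝ (Fin j)) Y₂)) (_ : z ∈ Y₁)
      (_ : z ∈ Y₂) (_ : 𝓝[Y₁] z = 𝓝[Y₂] z), j ≤ k := by
    intro k j Y₁ Y₂ h₁ h₂ hz₁ hz₂ h
    obtain ⟨N, ψ, θ, hNY, hN, hψ, hψz, hθ0, hθψ, hθ⟩ := exists_local_coordinates Y₁ h₁ hz₁
    have hθt : Filter.Tendsto θ (𝓝 0) (𝓝[Y₁] z) := by
      rw [tendsto_nhdsWithin_iff]
      refine ⟨?_, hθ.mono fun v hv => hNY hv.2.1⟩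
      have := hθ.self_of_nhds.1
      rwa [ContinuousAt, hθ0] at this
    refine le_of_isolated_zero_of_locallyEuclidean h₂ hz₂ (W := N) (h ▸ hN) hψ ?_ (s := θ) ?_ hθ0
    · intro x hx h0
      rw [← hθψ x hx, h0, hθ0]
    · have h3 : ∀ᶠ v in 𝓝 0, θ v ∈ Y₂ := hθt.eventually (h ▸ self_mem_nhdsWithin)
      filter_upwards [hθ, h3] with v hv hv'
      exact ⟨hv.1, hv', hv.2.2⟩
  exact le_antisymm (key h₂ h₁ hz₂ hz₁ h.symm) (key h₁ h₂ hz₁ hz₂ h)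

end LocallyEuclidean

end CSCoarsening

namespace CSCoarsening
open Set Topology

/-! ### Connectedness and local path connectedness. -/

section Connectedness

variable {X : Type*} [TopologicalSpace X]

/-- Points of a locally Euclidean subspace have small path connected neighbourhoods. -/
theorem exists_isPathConnected_nhds {n : ℕ} (Y : Set X)
    (hY : Nonempty (ChartedSpace (EuclideanSpace ℝ (Fin n)) Y)) {z : X} (hz : z ∈ Y)
    {W : Set X} (hW : W ∈ 𝓝[Y] z) :
    ∃ C : Set X, C ⊆ W ∧ C ⊆ Y ∧ z ∈ C ∧ C ∈ 𝓝[Y] z ∧ IsPathConnected C := by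
  obtain ⟨N, ψ, θ, hNY, hN, hψ, hψz, hθ0, hθψ, hθ⟩ := exists_local_coordinates Y hY hz
  have hθt : Filter.Tendsto θ (𝓝 0) (𝓝[Y] z) := by
    rw [tendsto_nhdsWithin_iff]
    refine ⟨?_, hθ.mono fun v hv => hNY hv.2.1⟩
    have := hθ.self_of_nhds.1
    rwa [ContinuousAt, hθ0] at this
  obtain ⟨δ, hδ, hδW⟩ := Metric.nhds_basis_ball.eventually_iff.1 (hθ.and (hθt.eventually hW))
  refine ⟨θ '' Metric.ball 0 δ, ?_, ?_, ⟨0, Metric.mem_ball_self hδ, hθ0⟩, ?_, ?_⟩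
  · rintro _ ⟨v, hv, rfl⟩
    exact (hδW hv).2
  · rintro _ ⟨v, hv, rfl⟩
    exact hNY (hδW hv).1.2.1
  · have hzN : z ∈ N := mem_of_mem_nhdsWithin hz hN
    have h1 := hψ z hzN
    rw [ContinuousWithinAt, hψz] at h1
    have h2 : ψ ⁻¹' Metric.ball 0 δ ∈ 𝓝[Y] z :=
      nhdsWithin_le_of_mem hN (h1 (Metric.ball_mem_nhds _ hδ))
    filter_upwards [hN, h2] with x hx hx'
    exact ⟨ψ x, hx', hθψ x hx⟩
  · refine ((convex_ball (0 : EuclideanSpace ℝ (Fin n)) δ).isPathConnected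
      ⟨0, Metric.mem_ball_self hδ⟩).image' ?_
    exact fun v hv => (hδW hv).1.1.continuousWithinAt

/-- Removing a closed nowhere dense subset which does not separate locally preserves
connectedness. -/
theorem isPreconnected_diff_of_locally {K A : Set X} (hK : IsPreconnected K) (hKo : IsOpen K)
    (hloc : ∀ a ∈ K, a ∈ A → ∃ N ∈ 𝓝 a, N ⊆ K ∧ IsPreconnected (N \ A))
    (hd : ∀ a ∈ K, a ∈ A → ∃ᶠ y in 𝓝 a, y ∉ A) : IsPreconnected (K \ A) := by
  intro u v hu hv huv hKu hKv
  by_contra hne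
  -- Near a point of `A`, the connected set `N \ A` lies in `u` or in `v`. The connectedness of `K`
  -- then gives a point in both interiors, and points off `A` near it lie in `u ∩ v`.
  have hcov : K ⊆ interior (A ∪ u) ∪ interior (A ∪ v) := by
    intro a ha
    by_cases haA : a ∈ A
    · obtain ⟨N, hN, hNK, hNp⟩ := hloc a ha haA
      have h1 : N \ A ⊆ K \ A := sdiff_subset_sdiff_left hNK
      have h2 : N \ A ∩ (u ∩ v) = ∅ := by
        rw [← not_nonempty_iff_eq_empty]
        exact fun h => hne (h.mono (inter_subset_inter_left _ h1))
      rcases isPreconnected_iff_subset_of_disjoint.1 hNp u v hu hv (h1.trans huv) h2 with h | h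
      · exact Or.inl (mem_interior_iff_mem_nhds.2 (Filter.mem_of_superset hN (sdiff_subset_iff.1 h)))
      · exact Or.inr (mem_interior_iff_mem_nhds.2 (Filter.mem_of_superset hN (sdiff_subset_iff.1 h)))
    · rcases huv ⟨ha, haA⟩ with h | h
      · exact Or.inl (interior_mono subset_union_right (hu.interior_eq.symm ▸ h))
      · exact Or.inr (interior_mono subset_union_right (hv.interior_eq.symm ▸ h))
  obtain ⟨a, haK, hau, hav⟩ := hK _ _ isOpen_interior isOpen_interior hcov
    (hKu.mono fun a ha => ⟨ha.1.1, interior_mono subset_union_right (hu.interior_eq.symm ▸ ha.2)⟩)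
    (hKv.mono fun a ha => ⟨ha.1.1, interior_mono subset_union_right (hv.interior_eq.symm ▸ ha.2)⟩)
  have hex : ∃ b ∉ A, b ∈ K ∧ b ∈ A ∪ u ∧ b ∈ A ∪ v := by
    by_cases haA : a ∈ A
    · have h1 : ∀ᶠ y in 𝓝 a, y ∈ K ∧ y ∈ A ∪ u ∧ y ∈ A ∪ v :=
        Filter.Eventually.and (hKo.mem_nhds haK) (Filter.Eventually.and
          (mem_interior_iff_mem_nhds.1 hau) (mem_interior_iff_mem_nhds.1 hav))
      obtain ⟨b, hb, hb'⟩ := ((hd a haK haA).and_eventually h1).exists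
      exact ⟨b, hb, hb'⟩
    · exact ⟨a, haA, haK, interior_subset hau, interior_subset hav⟩
  obtain ⟨b, hbA, hbK, hbu, hbv⟩ := hex
  exact hne ⟨b, ⟨hbK, hbA⟩, hbu.resolve_left hbA, hbv.resolve_left hbA⟩

/-- Preconnected sets that are locally path connected have all their points joined. -/
theorem joinedIn_of_isPreconnected {A : Set X} (hA : IsPreconnected A)
    (hloc : ∀ z ∈ A, ∃ C ∈ 𝓝[A] z, C ⊆ A ∧ z ∈ C ∧ IsPathConnected C) {x y : X} (hx : x ∈ A)
    (hy : y ∈ A) : JoinedIn A x y := by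
  refine hA.induction₂ (JoinedIn A) ?_ ?_ ?_ hx hy
  · intro z hz
    obtain ⟨C, hC, hCA, hzC, hCp⟩ := hloc z hz
    filter_upwards [hC] with w hw
    exact (hCp.joinedIn z hzC w hw).mono hCA
  · intro a b c _ _ _ h1 h2
    exact h1.trans h2
  · intro a b _ _ h
    exact h.symm

end Connectedness

/-! ### Levels of points and strata. -/

namespace Filtration

variable {X Y : Type*} [TopologicalSpace X] [TopologicalSpace Y] {n m : ℕ}

theorem skel_eq_empty (F : Filtration X n) {i : ℤ} (hi : i < 0) : F.skel i = ∅ :=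
  subset_eq_empty (F.mono (by omega : i ≤ -1)) F.skel_neg_one

theorem exists_mem_skel (F : Filtration X n) (x : X) : ∃ i : ℕ, x ∈ F.skel i :=
  ⟨n, by rw [F.skel_dim]; trivial⟩

open Classical in
/-- The index of the layer containing a point. -/
noncomputable def level (F : Filtration X n) (x : X) : ℕ := Nat.find (F.exists_mem_skel x)

theorem mem_skel_iff (F : Filtration X n) {x : X} {i : ℤ} : x ∈ F.skel i ↔ (F.level x : ℤ) ≤ i := by
  classical
  constructor
  · intro h
    by_contra! hlt
    rcases lt_or_ge i 0 with hi | hi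
    · rw [F.skel_eq_empty hi] at h
      exact h
    · lift i to ℕ using hi
      exact Nat.find_min (F.exists_mem_skel x) (by exact_mod_cast hlt) h
  · intro h
    exact F.mono h (Nat.find_spec (F.exists_mem_skel x))

theorem mem_layer_iff (F : Filtration X n) {x : X} {i : ℤ} :
    x ∈ F.layer i ↔ (F.level x : ℤ) = i := by
  rw [layer, mem_sdiff, F.mem_skel_iff, F.mem_skel_iff]
  omega

theorem level_le (F : Filtration X n) (x : X) : F.level x ≤ n := by
  have : x ∈ F.skel n := by rw [F.skel_dim]; trivial
  exact_mod_cast F.mem_skel_iff.1 this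

theorem isClosed_level_le (F : Filtration X n) (i : ℕ) : IsClosed {x | F.level x ≤ i} := by
  convert F.isClosed_skel i using 1
  ext x
  simp [F.mem_skel_iff]

theorem isOpen_lt_level (F : Filtration X n) (i : ℕ) : IsOpen {x | i < F.level x} := by
  have := (F.isClosed_level_le i).isOpen_compl
  simpa [compl_ofPred] using this

theorem isOpen_le_level (F : Filtration X n) (i : ℕ) : IsOpen {x | i ≤ F.level x} := by
  cases i with
  | zero => simp
  | succ i => simpa [Nat.succ_le_iff] using F.isOpen_lt_level i

theorem layer_dim_eq (F : Filtration X n) : F.layer n = {x | F.level x = n} := by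
  ext x
  simp [F.mem_layer_iff]

theorem isOpen_regular (F : Filtration X n) : IsOpen {x | F.level x = n} := by
  convert F.isOpen_le_level n using 2
  ext x
  have := F.level_le x
  constructor <;> intro h <;> omega

/-- The stratum through a point. -/
noncomputable def stratumAt (F : Filtration X n) (x : X) : F.Stratum :=
  ⟨F.level x, connectedComponentIn (F.layer (F.level x)) x, x, F.mem_layer_iff.2 rfl, rfl⟩

theorem mem_stratumAt (F : Filtration X n) (x : X) : x ∈ (F.stratumAt x).carrier :=
  mem_connectedComponentIn (F.mem_layer_iff.2 rfl)

namespace Stratum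

variable {F : Filtration X n}

theorem subset_layer (S : F.Stratum) : S.carrier ⊆ F.layer S.dim := by
  obtain ⟨x, hx, h⟩ := S.isComponent
  rw [h]
  exact connectedComponentIn_subset _ _

theorem nonempty (S : F.Stratum) : S.carrier.Nonempty := by
  obtain ⟨x, hx, h⟩ := S.isComponent
  exact ⟨x, h ▸ mem_connectedComponentIn hx⟩

theorem isPreconnected (S : F.Stratum) : IsPreconnected S.carrier := by
  obtain ⟨x, hx, h⟩ := S.isComponent
  rw [h]
  exact isPreconnected_connectedComponentIn

theorem level_eq {S : F.Stratum} {x : X} (hx : x ∈ S.carrier) : (F.level x : ℤ) = S.dim :=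
  F.mem_layer_iff.1 (S.subset_layer hx)

theorem eq_stratumAt {S : F.Stratum} {x : X} (hx : x ∈ S.carrier) : S = F.stratumAt x := by
  have hl := level_eq hx
  obtain ⟨d, C, y, hy, h⟩ := S
  simp only at hl hx h
  subst hl
  subst h
  have := connectedComponentIn_eq hx
  simp only [stratumAt, this]

theorem eq_of_mem {S Q : F.Stratum} {x : X} (hS : x ∈ S.carrier) (hQ : x ∈ Q.carrier) : S = Q :=
  (eq_stratumAt hS).trans (eq_stratumAt hQ).symm

/-- A connected subset of a layer which meets a stratum lies in it. -/
theorem subset_of_isPreconnected (S : F.Stratum) {C : Set X} (hC : IsPreconnected C)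
    (hl : ∀ y ∈ C, (F.level y : ℤ) = S.dim) {x : X} (hx : x ∈ C) (hxS : x ∈ S.carrier) :
    C ⊆ S.carrier := by
  obtain ⟨d, K, y, hy, h⟩ := S
  simp only at hl hxS h ⊢
  rw [h] at hxS ⊢
  rw [connectedComponentIn_eq hxS]
  exact hC.subset_connectedComponentIn hx fun z hz => F.mem_layer_iff.2 (hl z hz)

theorem dim_nonneg (S : F.Stratum) : 0 ≤ S.dim := by
  obtain ⟨x, hx⟩ := S.nonempty
  rw [← level_eq hx]
  positivity

theorem dim_le (S : F.Stratum) : S.dim ≤ n := by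
  obtain ⟨x, hx⟩ := S.nonempty
  rw [← level_eq hx]
  exact_mod_cast F.level_le x

end Stratum

/-- A stratified homeomorphism preserves codimensions. -/
theorem IsStratifiedHomeo.level_eq {F : Filtration X n} {G : Filtration Y m} {e : X ≃ₜ Y}
    (h : IsStratifiedHomeo F G e) (x : X) :
    (m : ℤ) - G.level (e x) = n - F.level x := by
  apply le_antisymm
  · obtain ⟨T, hT, hle⟩ := h.1.2 (F.stratumAt x)
    have h1 := Stratum.level_eq (hT (F.mem_stratumAt x))
    rw [h1]
    exact hle
  · obtain ⟨T, hT, hle⟩ := h.2.2 (G.stratumAt (e x))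
    have h1 := Stratum.level_eq (hT (G.mem_stratumAt (e x)))
    rw [e.symm_apply_apply] at h1
    rw [h1]
    exact hle

theorem level_congr {F : Filtration X n} {G : Filtration Y m} {x : X} {y : Y}
    (h : ∀ i, x ∈ F.skel i ↔ y ∈ G.skel i) : F.level x = G.level y := by
  have h1 := (G.mem_skel_iff (x := y) (i := F.level x)).1 ((h _).1 (F.mem_skel_iff.2 le_rfl))
  have h2 := (F.mem_skel_iff (x := x) (i := G.level y)).1 ((h _).2 (G.mem_skel_iff.2 le_rfl))
  omega

theorem level_induced (F : Filtration X n) (V : Set X) (x : V) :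
    (F.induced V).level x = F.level (x : X) :=
  level_congr fun _ => Iff.rfl

theorem level_prodLeft (F : Filtration X n) (z : Y × X) : (F.prodLeft Y).level z = F.level z.2 :=
  level_congr fun _ => Iff.rfl

end Filtration

/-! ### Topology and levels of the open cone. -/

namespace OpenCone

variable {L : Type*}

theorem mk_eq_mk_iff {l l' : L} {t t' : Ico (0 : ℝ) 1} :
    mk l t = mk l' t' ↔ (l = l' ∧ t = t') ∨ ((t : ℝ) = 0 ∧ (t' : ℝ) = 0) := by
  constructor
  · intro h
    rcases Quotient.exact h with h | h
    · exact Or.inl (Prod.mk.inj h)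
    · exact Or.inr h
  · rintro (⟨rfl, rfl⟩ | h)
    · rfl
    · exact Quotient.sound (Or.inr h)

theorem mk_eq_apex {l l' : L} {t : Ico (0 : ℝ) 1} (ht : (t : ℝ) = 0) : mk l t = apex l' :=
  mk_eq_mk_iff.2 (Or.inr ⟨ht, rfl⟩)

theorem exists_eq_mk (c : OpenCone L) : ∃ l t, c = mk l t := by
  induction c using Quotient.inductionOn with
  | h a => exact ⟨a.1, a.2, rfl⟩

theorem isQuotientMap_mk [TopologicalSpace L] :
    IsQuotientMap (fun a : L × Ico (0 : ℝ) 1 => mk a.1 a.2) :=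
  isQuotientMap_quot_mk

theorem continuous_mk [TopologicalSpace L] :
    Continuous (fun a : L × Ico (0 : ℝ) 1 => mk a.1 a.2) :=
  isQuotientMap_mk.continuous

/-- The truncated cones form a neighbourhood basis of the apex. -/
theorem nhds_apex [TopologicalSpace L] [CompactSpace L] (l₀ : L) {B : Set (OpenCone L)} :
    B ∈ 𝓝 (apex l₀) ↔ ∃ ε : ℝ, 0 < ε ∧ ε ≤ 1 ∧ ∀ (l : L) (t : Ico (0 : ℝ) 1), (t : ℝ) < ε → mk l t ∈ B := by
  constructor
  · intro hB
    have h0 : (0 : ℝ) ∈ Ico (0 : ℝ) 1 := by norm_num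
    have h1 : ∀ l ∈ (univ : Set L), ∀ᶠ a : Ico (0 : ℝ) 1 × L in 𝓝 (⟨0, h0⟩, l), mk a.2 a.1 ∈ B := by
      intro l _
      have hc : ContinuousAt (fun a : Ico (0 : ℝ) 1 × L => mk a.2 a.1) (⟨0, h0⟩, l) :=
        (continuous_mk.comp continuous_swap).continuousAt
      refine hc ?_
      have : mk l ⟨0, h0⟩ = apex l₀ := mk_eq_apex rfl
      change B ∈ 𝓝 (mk l ⟨0, h0⟩)
      rwa [this]
    -- Compactness of `L` enters here, through the tube lemma.
    have h2 : ∀ᶠ t : Ico (0 : ℝ) 1 in 𝓝 ⟨0, h0⟩, ∀ l ∈ (univ : Set L), mk l t ∈ B :=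
      isCompact_univ.eventually_forall_of_forall_eventually h1
    rw [Filter.Eventually, nhds_subtype_eq_comap, Filter.mem_comap] at h2
    obtain ⟨s, hs, hsB⟩ := h2
    obtain ⟨ε, hε, hεs⟩ := Metric.mem_nhds_iff.1 hs
    refine ⟨min ε 1, by positivity, min_le_right _ _, fun l t ht => ?_⟩
    have h3 : (t : ℝ) ∈ s := by
      refine hεs ?_
      rw [Metric.mem_ball, Real.dist_eq, sub_zero, abs_of_nonneg t.2.1]
      exact ht.trans_le (min_le_left _ _)
    exact hsB (show t ∈ Subtype.val ⁻¹' s from h3) l trivial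
  · rintro ⟨ε, hε, -, hεB⟩
    have hopen : IsOpen {c : OpenCone L | ∃ (l : L) (t : Ico (0 : ℝ) 1), (t : ℝ) < ε ∧ c = mk l t} := by
      refine isQuotientMap_mk.isOpen_preimage.1 ?_
      have : (fun a : L × Ico (0 : ℝ) 1 => mk a.1 a.2) ⁻¹'
          {c : OpenCone L | ∃ (l : L) (t : Ico (0 : ℝ) 1), (t : ℝ) < ε ∧ c = mk l t} = {a | (a.2 : ℝ) < ε} := by
        ext ⟨l, t⟩
        constructor
        · rintro ⟨l', t', ht', h⟩
          rcases mk_eq_mk_iff.1 h with ⟨-, rfl⟩ | ⟨h0, -⟩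
          · exact ht'
          · exact h0.trans_lt hε
        · intro h
          exact ⟨l, t, h, rfl⟩
      rw [this]
      exact isOpen_lt (by fun_prop) continuous_const
    refine Filter.mem_of_superset (hopen.mem_nhds ⟨l₀, ⟨0, by norm_num⟩, hε, rfl⟩) ?_
    rintro _ ⟨l, t, ht, rfl⟩
    exact hεB l t ht

end OpenCone

namespace Filtration

theorem level_cone_mk {L : Type*} [TopologicalSpace L] {m : ℕ} (G : Filtration L m) (l : L)
    {t : Ico (0 : ℝ) 1} (ht : 0 < (t : ℝ)) : G.cone.level (OpenCone.mk l t) = G.level l + 1 := by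
  have key : ∀ i, OpenCone.mk l t ∈ G.cone.skel i ↔ l ∈ G.skel (i - 1) := by
    intro i
    constructor
    · rintro ⟨hi, l', t', h, h'⟩
      rcases OpenCone.mk_eq_mk_iff.1 h with ⟨rfl, rfl⟩ | ⟨h0, -⟩
      · exact h'.resolve_left ht.ne'
      · exact absurd h0 ht.ne'
    · intro h
      refine ⟨?_, l, t, rfl, Or.inr h⟩
      have := G.mem_skel_iff.1 h
      omega
  have h1 := (key _).1 (G.cone.mem_skel_iff.2 (le_refl (G.cone.level (OpenCone.mk l t) : ℤ)))
  rw [G.mem_skel_iff] at h1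
  have h2 := G.cone.mem_skel_iff.1 ((key (G.level l + 1)).2 (G.mem_skel_iff.2 (by omega)))
  omega

theorem IsFilteredSpace.exists_level_eq {L : Type*} [TopologicalSpace L] {m : ℕ}
    {G : Filtration L m} (h : G.IsFilteredSpace) : ∃ l, G.level l = m := by
  by_contra! hne
  refine h (eq_univ_of_forall fun l => ?_)
  have h1 := G.level_le l
  have h2 := hne l
  rw [G.mem_skel_iff]
  omega

end Filtration

end CSCoarsening

/-! ### Conical charts and connectedness of links. -/

namespace CSCoarsening
open Set Topology

/-- A conical chart `φ` at a point, together with the levels of the points of the link. -/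
structure ConeChart {X : Type u} [TopologicalSpace X] {n : ℕ} (F : Filtration X n) (x : X) where
  U : Set X
  V : Set X
  isOpen : IsOpen V
  mem_V : x ∈ V
  L : Type u
  [top : TopologicalSpace L]
  [compact : CompactSpace L]
  φ : (U × OpenCone L) ≃ₜ V
  mem : x ∈ U
  subset_layer : U ⊆ F.layer (F.level x)
  mem_nhdsWithin : U ∈ 𝓝[F.layer (F.level x)] x
  map_apex : ∀ (u : U) (l : L), (φ (u, OpenCone.apex l) : X) = u
  linkLevel : L → ℕ
  level_eq : ∀ (u : U) (l : L) (t : Ico (0 : ℝ) 1), 0 < (t : ℝ) →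
    F.level (φ (u, OpenCone.mk l t) : X) = linkLevel l
  lt_linkLevel : ∀ l, F.level x < linkLevel l
  exists_linkLevel : ∃ l, linkLevel l = n

attribute [instance] ConeChart.top ConeChart.compact

theorem IsCSSet.nonempty_coneChart {X : Type u} [TopologicalSpace X] {n : ℕ} {F : Filtration X n}
    (hF : IsCSSet F) {x : X} (hx : F.level x < n) : Nonempty (ConeChart F x) := by
  obtain ⟨V, U, hV, hxV, hxU, ⟨O, hO, rfl⟩, L, tL, cL, -, m, hm, G, hG, φ, hφ, hφa⟩ :=
    hF.conical (F.level x) hx x (F.mem_layer_iff.2 rfl)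
  -- Stratified homeomorphisms preserve codimension, so levels off the apex are link levels shifted
  -- by `F.level x + 1`. This function of `l` is all that is kept of the filtration of the link.
  have hlev : ∀ (u : (F.layer (F.level x) ∩ O : Set X)) (l : L) (t : Ico (0 : ℝ) 1),
      0 < (t : ℝ) → F.level (φ (u, OpenCone.mk l t) : X) = F.level x + (G.level l + 1) := by
    intro u l t ht
    have := hφ.level_eq (u, OpenCone.mk l t)
    rw [Filtration.level_induced, Filtration.level_prodLeft, Filtration.level_cone_mk G l ht] at this
    push_cast at this
    omega
  exact ⟨{
    U := F.layer (F.level x) ∩ O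
    V := V
    isOpen := hV
    mem_V := hxV
    L := L
    φ := φ
    mem := hxU
    subset_layer := inter_subset_left
    mem_nhdsWithin := inter_mem_nhdsWithin _ (hO.mem_nhds hxU.2)
    map_apex := hφa
    linkLevel := fun l => F.level x + (G.level l + 1)
    level_eq := hlev
    lt_linkLevel := fun l => by omega
    exists_linkLevel := by
      obtain ⟨l, hl⟩ := hG.exists_level_eq
      exact ⟨l, by omega⟩ }⟩

namespace ConeChart

variable {X : Type u} [TopologicalSpace X] {n : ℕ} {F : Filtration X n} {x : X}
  (c : ConeChart F x)

/-- The point of `X` with given chart coordinates. -/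
def pt (u : c.U) (l : c.L) (t : Ico (0 : ℝ) 1) : X := c.φ (u, OpenCone.mk l t)

theorem continuous_pt :
    Continuous (fun a : c.U × c.L × Ico (0 : ℝ) 1 => c.pt a.1 a.2.1 a.2.2) :=
  continuous_subtype_val.comp (c.φ.continuous.comp
    (continuous_fst.prodMk (OpenCone.continuous_mk.comp continuous_snd)))

theorem pt_zero (u : c.U) (l : c.L) {t : Ico (0 : ℝ) 1} (ht : (t : ℝ) = 0) : c.pt u l t = u := by
  rw [pt, OpenCone.mk_eq_apex (l' := l) ht, c.map_apex]

theorem level_pt (u : c.U) (l : c.L) {t : Ico (0 : ℝ) 1} (ht : 0 < (t : ℝ)) :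
    F.level (c.pt u l t) = c.linkLevel l :=
  c.level_eq u l t ht

theorem level_pt_zero (u : c.U) (l : c.L) {t : Ico (0 : ℝ) 1} (ht : (t : ℝ) = 0) :
    F.level (c.pt u l t) = F.level x := by
  rw [c.pt_zero u l ht]
  exact_mod_cast F.mem_layer_iff.1 (c.subset_layer u.2)

/-- The truncated neighbourhood over `C ⊆ U` of radius `ε`. -/
def truncated (C : Set X) (ε : ℝ) : Set X :=
  {y | ∃ (u : c.U) (l : c.L) (t : Ico (0 : ℝ) 1), (u : X) ∈ C ∧ (t : ℝ) < ε ∧ y = c.pt u l t}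

theorem truncated_mem_nhds {C : Set X} (hC : C ∈ 𝓝[F.layer (F.level x)] x) {ε : ℝ} (hε : 0 < ε) :
    c.truncated C ε ∈ 𝓝 x := by
  obtain ⟨l₀, -⟩ := c.exists_linkLevel
  have h1 : (Subtype.val ⁻¹' C : Set c.U) ∈ 𝓝 (⟨x, c.mem⟩ : c.U) := by
    rw [mem_nhds_subtype_iff_nhdsWithin]
    rw [Subtype.image_preimage_coe]
    exact Filter.inter_mem self_mem_nhdsWithin (nhdsWithin_mono _ c.subset_layer hC)
  have h2 : {a : OpenCone c.L | ∃ (l : c.L) (t : Ico (0 : ℝ) 1), (t : ℝ) < ε ∧ a = OpenCone.mk l t} ∈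
      𝓝 (OpenCone.apex l₀) :=
    (OpenCone.nhds_apex l₀).2 ⟨min ε 1, by positivity, min_le_right _ _, fun l t ht =>
      ⟨l, t, ht.trans_le (min_le_left _ _), rfl⟩⟩
  have h3 := prod_mem_nhds h1 h2
  have h4 := Filter.image_mem_map (m := fun a => (c.φ a : X)) h3
  have h5 : Filter.map (fun a => (c.φ a : X)) (𝓝 (⟨x, c.mem⟩, OpenCone.apex l₀)) = 𝓝 x := by
    have h6 : (fun a => (c.φ a : X)) = Subtype.val ∘ c.φ := rfl
    rw [h6, ← Filter.map_map, c.φ.map_nhds_eq, map_nhds_subtype_coe_eq_nhds, c.map_apex]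
    rw [c.map_apex]
    exact c.isOpen.mem_nhds c.mem_V
  rw [h5] at h4
  refine Filter.mem_of_superset h4 ?_
  rintro _ ⟨⟨u, a⟩, ⟨hu, l, t, ht, ha⟩, rfl⟩
  exact ⟨u, l, t, hu, ht, by simp only at ha; rw [ha, pt]⟩

/-- The product topology, the basis at the apex and path connected neighbourhoods in the layer give
a neighbourhood basis over connected bases `C`. -/
theorem exists_truncated_subset
    (hF : Nonempty (ChartedSpace (EuclideanSpace ℝ (Fin (F.level x))) (F.layer (F.level x))))
    {W : Set X} (hW : W ∈ 𝓝 x) :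
    ∃ (C : Set X) (ε : ℝ), 0 < ε ∧ ε ≤ 1 ∧ C ⊆ c.U ∧ x ∈ C ∧ IsPreconnected C ∧
      C ∈ 𝓝[F.layer (F.level x)] x ∧ c.truncated C ε ⊆ W := by
  obtain ⟨l₀, -⟩ := c.exists_linkLevel
  have h1 : (fun a => (c.φ a : X)) ⁻¹' W ∈ 𝓝 ((⟨x, c.mem⟩ : c.U), OpenCone.apex l₀) := by
    refine (continuous_subtype_val.comp c.φ.continuous).continuousAt ?_
    simpa [c.map_apex] using hW
  obtain ⟨A, hA, B, hB, hAB⟩ := mem_nhds_prod_iff.1 h1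
  obtain ⟨ε, hε, hε1, hεB⟩ := (OpenCone.nhds_apex l₀).1 hB
  have hA' : Subtype.val '' A ∈ 𝓝[F.layer (F.level x)] x := by
    refine nhdsWithin_le_of_mem c.mem_nhdsWithin ?_
    rw [← map_nhds_subtype_val ⟨x, c.mem⟩]
    exact Filter.image_mem_map hA
  obtain ⟨C, hCA, -, hxC, hC, hCp⟩ := exists_isPathConnected_nhds _ hF (F.mem_layer_iff.2 rfl) hA'
  refine ⟨C, ε, hε, hε1, hCA.trans ?_, hxC, hCp.isConnected.isPreconnected, hC, ?_⟩
  · rintro _ ⟨u, -, rfl⟩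
    exact u.2
  · rintro _ ⟨u, l, t, hu, ht, rfl⟩
    obtain ⟨u', hu', h⟩ := hCA hu
    obtain rfl := Subtype.ext h
    exact hAB (show (u', OpenCone.mk l t) ∈ A ×ˢ B from ⟨hu', hεB l t ht⟩)

/-- In a truncated neighbourhood over a connected base, the points with the same link coordinate
off the apex form a connected subset of a layer. -/
theorem isPreconnected_ray {C : Set X} (hC : IsPreconnected C) (hCU : C ⊆ c.U) (l : c.L) :
    IsPreconnected {y | ∃ (u : c.U) (t : Ico (0 : ℝ) 1), (u : X) ∈ C ∧ 0 < (t : ℝ) ∧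
      y = c.pt u l t} := by
  have h1 : IsPreconnected (Subtype.val ⁻¹' C : Set c.U) := by
    refine IsInducing.subtypeVal.isPreconnected_image.1 ?_
    rwa [Subtype.image_preimage_coe, inter_eq_right.2 hCU]
  have h2 : _root_.IsPreconnected {t : Ico (0 : ℝ) 1 | 0 < (t : ℝ)} := by
    refine IsInducing.subtypeVal.isPreconnected_image.1 ?_
    have : Subtype.val '' {t : Ico (0 : ℝ) 1 | 0 < (t : ℝ)} = Ioo 0 1 := by
      ext t
      constructor
      · rintro ⟨t, ht, rfl⟩
        exact ⟨ht, t.2.2⟩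
      · intro ht
        exact ⟨⟨t, ht.1.le, ht.2⟩, ht.1, rfl⟩
    rw [this]
    exact isPreconnected_Ioo
  have h3 : Continuous fun a : c.U × Ico (0 : ℝ) 1 => c.pt a.1 l a.2 :=
    c.continuous_pt.comp (continuous_fst.prodMk (continuous_const.prodMk continuous_snd))
  convert (h1.prod h2).image _ h3.continuousOn using 1
  ext y
  constructor
  · rintro ⟨u, t, hu, ht, rfl⟩
    exact ⟨(u, t), ⟨hu, ht⟩, rfl⟩
  · rintro ⟨⟨u, t⟩, ⟨hu, ht⟩, rfl⟩
    exact ⟨u, t, hu, ht, rfl⟩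

/-- The complement of the apex locus in a truncated neighbourhood is connected if the link is. -/
theorem isPreconnected_truncated_diff [PreconnectedSpace c.L] {C : Set X} (hC : IsPreconnected C)
    (hCU : C ⊆ c.U) {ε : ℝ} (hε1 : ε ≤ 1) :
    IsPreconnected (c.truncated C ε \ F.layer (F.level x)) := by
  have h1 : IsPreconnected (Subtype.val ⁻¹' C : Set c.U) := by
    refine IsInducing.subtypeVal.isPreconnected_image.1 ?_
    rwa [Subtype.image_preimage_coe, inter_eq_right.2 hCU]
  have h2 : _root_.IsPreconnected {t : Ico (0 : ℝ) 1 | 0 < (t : ℝ) ∧ (t : ℝ) < ε} := by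
    refine IsInducing.subtypeVal.isPreconnected_image.1 ?_
    have : Subtype.val '' {t : Ico (0 : ℝ) 1 | 0 < (t : ℝ) ∧ (t : ℝ) < ε} = Ioo 0 ε := by
      ext t
      constructor
      · rintro ⟨t, ht, rfl⟩
        exact ht
      · intro ht
        exact ⟨⟨t, ht.1.le, ht.2.trans_le hε1⟩, ht, rfl⟩
    rw [this]
    exact isPreconnected_Ioo
  convert (h1.prod (isPreconnected_univ.prod h2)).image _ c.continuous_pt.continuousOn using 1
  ext y
  constructor
  · rintro ⟨⟨u, l, t, hu, ht, rfl⟩, hy⟩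
    refine ⟨(u, l, t), ⟨hu, trivial, ?_, ht⟩, rfl⟩
    refine lt_of_le_of_ne t.2.1 fun h0 => hy ?_
    rw [F.mem_layer_iff, c.level_pt_zero u l h0.symm]
  · rintro ⟨⟨u, l, t⟩, ⟨hu, -, ht0, ht⟩, rfl⟩
    refine ⟨⟨u, l, t, hu, ht, rfl⟩, fun hy => ?_⟩
    have h3 : (F.level (c.pt u l t) : ℤ) = F.level x := F.mem_layer_iff.1 hy
    have h4 := c.level_pt (t := t) u l ht0
    have h5 := c.lt_linkLevel l
    omega

/-- Near a point of an `n`-manifold, the link of a stratum of codimension at least two is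
connected. -/
theorem preconnectedSpace_link {d : ℕ} {Y : Set X}
    (hF : Nonempty (ChartedSpace (EuclideanSpace ℝ (Fin (F.level x))) (F.layer (F.level x))))
    (hY : Nonempty (ChartedSpace (EuclideanSpace ℝ (Fin d)) Y)) (hxY : Y ∈ 𝓝 x)
    (hd : F.level x + 2 ≤ d) : PreconnectedSpace c.L := by
  classical
  rw [preconnectedSpace_iff_clopen]
  by_contra! hcon
  obtain ⟨A, hA, ⟨a, ha⟩, hAu⟩ := hcon
  obtain ⟨b, hb⟩ := (ne_univ_iff_exists_notMem A).1 hAu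
  set i := F.level x with hi
  -- Let the link split into a clopen `A` containing `a` and a complement containing `b`. The base
  -- coordinates together with the cone radius, signed by `χ`, give a map `f` to `ℝⁱ⁺¹` vanishing
  -- only at `x`. The rays through `a` and `b` join at the apex into a line `k`, which gives a
  -- section `s`. Hence `d ≤ i + 1`, a contradiction.
  let e : (EuclideanSpace ℝ (Fin i) × ℝ) ≃L[ℝ] EuclideanSpace ℝ (Fin (i + 1)) :=
    ContinuousLinearEquiv.ofFinrankEq (by simp)
  have hxl : x ∈ F.layer i := F.mem_layer_iff.2 rfl
  obtain ⟨N, ψ, θ, hNl, hN, hψ, hψx, hθ0, hθψ, hθ⟩ := exists_local_coordinates _ hF hxl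
  let χ : c.L → ℝ := A.piecewise (fun _ => 1) (fun _ => -1)
  have hχ : Continuous χ := by
    refine Continuous.piecewise ?_ continuous_const continuous_const
    simp [hA.frontier_eq]
  have hχ0 : ∀ l, χ l ≠ 0 := by
    intro l
    by_cases hl : l ∈ A <;> simp [χ, hl]
  let g : OpenCone c.L → ℝ := Quotient.lift (fun p => χ p.1 * (p.2 : ℝ)) (by
    rintro p q (rfl | ⟨h, h'⟩)
    · rfl
    · simp [h, h'])
  have hg : Continuous g :=
    Continuous.quotient_lift ((hχ.comp continuous_fst).mul
      (continuous_subtype_val.comp continuous_snd)) _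
  have hgmk : ∀ l t, g (OpenCone.mk l t) = χ l * (t : ℝ) := fun l t => rfl
  let f : X → EuclideanSpace ℝ (Fin (i + 1)) := fun y =>
    if h : y ∈ c.V then e (ψ (c.φ.symm ⟨y, h⟩).1, g (c.φ.symm ⟨y, h⟩).2) else 0
  have hf : ∀ u a, f (c.φ (u, a)) = e (ψ u, g a) := by
    intro u a
    simp [f]
  have hxW : c.truncated N 1 ∈ 𝓝 x := c.truncated_mem_nhds hN one_pos
  -- Clamping to `[0, 1/2]` makes the radius total and continuous; only small parameters matter.
  let pr : ℝ → Ico (0 : ℝ) 1 := fun τ => ⟨max 0 (min τ (1 / 2)), le_max_left _ _,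
    max_lt one_pos ((min_le_right _ _).trans_lt (by norm_num))⟩
  have hpr : Continuous pr := by
    refine Continuous.subtype_mk ?_ _
    fun_prop
  let k : ℝ → OpenCone c.L := fun τ => if 0 ≤ τ then OpenCone.mk a (pr τ) else
    OpenCone.mk b (pr (-τ))
  have hk : Continuous k := by
    refine continuous_if_le continuous_const continuous_id ?_ ?_ ?_
    · exact (OpenCone.continuous_mk.comp (continuous_const.prodMk hpr)).continuousOn
    · exact (OpenCone.continuous_mk.comp
        (continuous_const.prodMk (hpr.comp continuous_neg))).continuousOn
    · rintro τ rfl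
      exact OpenCone.mk_eq_mk_iff.2 (Or.inr ⟨by simp [pr], by simp [pr]⟩)
  have hgk : ∀ τ, |τ| ≤ 1 / 2 → g (k τ) = τ := by
    intro τ hτ
    rw [abs_le] at hτ
    by_cases h0 : 0 ≤ τ
    · simp only [k, h0, if_true, hgmk, χ, ha, piecewise_eq_of_mem, pr]
      rw [min_eq_left hτ.2, max_eq_right h0, one_mul]
    · simp only [k, h0, if_false, hgmk, χ, hb, not_false_eq_true, piecewise_eq_of_notMem, pr]
      rw [min_eq_left (by linarith), max_eq_right (by linarith)]
      ring
  -- The default `x` is irrelevant: `θ w ∈ c.U` for `w` near `0`.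
  let r : EuclideanSpace ℝ (Fin i) → c.U := fun w =>
    if h : θ w ∈ c.U then ⟨θ w, h⟩ else ⟨x, c.mem⟩
  have hr : ∀ w, θ w ∈ c.U → (r w : X) = θ w := by
    intro w hw
    simp [r, hw]
  have hθU : ∀ᶠ w in 𝓝 0, θ w ∈ c.U := by
    have : Filter.Tendsto θ (𝓝 0) (𝓝[F.layer i] x) := by
      rw [tendsto_nhdsWithin_iff]
      refine ⟨?_, hθ.mono fun v hv => hNl hv.2.1⟩
      have := hθ.self_of_nhds.1
      rwa [ContinuousAt, hθ0] at this
    exact this.eventually c.mem_nhdsWithin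
  have hrc : ∀ᶠ w in 𝓝 0, ContinuousAt r w := by
    filter_upwards [hθ, hθU.eventually_nhds] with w hw hwU
    rw [IsInducing.subtypeVal.continuousAt_iff]
    exact hw.1.congr (hwU.mono fun w' hw' => (hr w' hw').symm)
  let s : EuclideanSpace ℝ (Fin (i + 1)) → X := fun v => c.φ (r (e.symm v).1, k (e.symm v).2)
  have he1 : Filter.Tendsto (fun v => (e.symm v).1) (𝓝 0) (𝓝 0) := by
    have : Continuous fun v => (e.symm v).1 := by fun_prop
    simpa using this.tendsto 0
  have he2 : Filter.Tendsto (fun v => (e.symm v).2) (𝓝 0) (𝓝 0) := by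
    have : Continuous fun v => (e.symm v).2 := by fun_prop
    simpa using this.tendsto 0
  have hsc : ∀ᶠ v in 𝓝 0, ContinuousAt s v := by
    filter_upwards [he1.eventually hrc] with v hv
    have h1 : ContinuousAt (fun v => r (e.symm v).1) v :=
      ContinuousAt.comp (f := fun v => (e.symm v).1) hv (by fun_prop)
    have h2 : ContinuousAt (fun v => k (e.symm v).2) v :=
      (hk.comp (by fun_prop : Continuous fun v => (e.symm v).2)).continuousAt
    exact (continuous_subtype_val.comp c.φ.continuous).continuousAt.comp (h1.prodMk h2)
  have hs0 : s 0 = x := by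
    have h1 : k 0 = OpenCone.apex a := by
      simp only [k, le_refl, if_true]
      exact OpenCone.mk_eq_apex (by simp [pr])
    have h2 : (r 0 : X) = x := by
      rw [hr 0 hθU.self_of_nhds, hθ0]
    simp only [s, map_zero, Prod.fst_zero, Prod.snd_zero, h1, c.map_apex, h2]
  have := le_of_isolated_zero_of_locallyEuclidean (d := i + 1) hY (mem_of_mem_nhds hxY)
    (W := c.truncated N 1) (mem_nhdsWithin_of_mem_nhds hxW) (f := f) ?_ ?_ (s := s) ?_ hs0
  · omega
  · have himg : c.truncated N 1 =
        Subtype.val '' (c.φ.symm ⁻¹' {p : c.U × OpenCone c.L | (p.1 : X) ∈ N}) := by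
      ext y
      constructor
      · rintro ⟨u, l, t, hu, -, rfl⟩
        exact ⟨c.φ (u, OpenCone.mk l t), by simpa using hu, rfl⟩
      · rintro ⟨y, hy, rfl⟩
        obtain ⟨⟨u, q⟩, rfl⟩ := c.φ.surjective y
        obtain ⟨l, t, rfl⟩ := OpenCone.exists_eq_mk q
        exact ⟨u, l, t, by simpa using hy, t.2.2, rfl⟩
    rw [himg, IsInducing.subtypeVal.continuousOn_image_iff]
    have h1 : f ∘ Subtype.val = (fun p : c.U × OpenCone c.L => e (ψ p.1, g p.2)) ∘ c.φ.symm := by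
      ext1 y
      obtain ⟨⟨u, q⟩, rfl⟩ := c.φ.surjective y
      simp [hf]
    rw [h1]
    refine ContinuousOn.comp (t := {p : c.U × OpenCone c.L | (p.1 : X) ∈ N}) ?_
      c.φ.symm.continuous.continuousOn fun y hy => hy
    refine e.continuous.comp_continuousOn (ContinuousOn.prodMk ?_ ?_)
    · exact hψ.comp (continuous_subtype_val.comp continuous_fst).continuousOn fun p hp => hp
    · exact (hg.comp continuous_snd).continuousOn
  · rintro y ⟨u, l, t, hu, -, rfl⟩ h0
    rw [pt, hf] at h0
    have h1 := Prod.mk.inj (e.map_eq_zero_iff.1 h0)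
    have h2 : (t : ℝ) = 0 := by
      have := h1.2
      rw [hgmk] at this
      exact (mul_eq_zero.1 this).resolve_left (hχ0 l)
    have h3 : ψ u = 0 := h1.1
    rw [c.pt_zero u l h2, ← hθψ u hu, h3, hθ0]
  · have hsY : ∀ᶠ v in 𝓝 0, s v ∈ Y := by
      have h1 : ContinuousAt s 0 := hsc.self_of_nhds
      rw [ContinuousAt, hs0] at h1
      exact h1.eventually hxY
    have hτ : ∀ᶠ τ : ℝ in 𝓝 0, |τ| ≤ 1 / 2 := by
      have := (continuous_abs (G := ℝ)).tendsto 0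
      rw [abs_zero] at this
      exact this.eventually (Iic_mem_nhds (by norm_num))
    filter_upwards [hsc, hsY, he1.eventually hθ, he1.eventually hθU, he2.eventually hτ] with
      v h1 h2 h3 h4 h5
    refine ⟨h1, h2, ?_⟩
    rw [hf, hr _ h4, hgk _ h5, h3.2.2, Prod.mk.eta, e.apply_symm_apply]

end ConeChart

end CSCoarsening

namespace CSCoarsening
open Set Topology

/-! ### Local structure of strata in a CS set. -/

namespace IsCSSet

variable {X : Type u} [TopologicalSpace X] {n : ℕ} {F : Filtration X n}

theorem manifold_dim (hF : IsCSSet F) : Nonempty (ChartedSpace (EuclideanSpace ℝ (Fin n))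
    {x | F.level x = n}) := by
  rw [← F.layer_dim_eq]
  exact hF.manifold n

/-- Strata are open in their layer. -/
theorem stratum_mem_nhdsWithin (hF : IsCSSet F) (S : F.Stratum) {x : X} (hx : x ∈ S.carrier) :
    S.carrier ∈ 𝓝[F.layer S.dim] x := by
  obtain ⟨i, hi⟩ := Int.eq_ofNat_of_zero_le S.dim_nonneg
  have hl := S.subset_layer hx
  have hm := hF.manifold i
  rw [hi] at hl ⊢
  obtain ⟨C, -, hCl, hxC, hC, hCp⟩ := exists_isPathConnected_nhds _ hm hl self_mem_nhdsWithin
  refine Filter.mem_of_superset hC (S.subset_of_isPreconnected hCp.isConnected.isPreconnected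
    (fun y hy => ?_) hxC hx)
  rw [hi]
  exact F.mem_layer_iff.1 (hCl hy)

theorem regular_mem_nhds (hF : IsCSSet F) {x : X} (hx : F.level x = n) {W : Set X} (hW : W ∈ 𝓝 x) :
    ∃ C ∈ 𝓝 x, C ⊆ W ∧ x ∈ C ∧ (∀ y ∈ C, F.level y = n) ∧ IsPathConnected C := by
  obtain ⟨C, hCW, hCl, hxC, hC, hCp⟩ := exists_isPathConnected_nhds _ hF.manifold_dim hx
    (mem_nhdsWithin_of_mem_nhds hW)
  rw [F.isOpen_regular.nhdsWithin_eq hx] at hC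
  exact ⟨C, hC, hCW, hxC, hCl, hCp⟩

/-- A punctured ray over a connected base is connected and of constant level, so a single stratum
contains it. -/
theorem _root_.CSCoarsening.ConeChart.ray_subset_stratumAt {x : X} (c : ConeChart F x) {C : Set X}
    (hC : IsPreconnected C) (hCU : C ⊆ c.U) {u u' : c.U} (hu : (u : X) ∈ C) (hu' : (u' : X) ∈ C)
    (l : c.L) {t t' : Ico (0 : ℝ) 1} (ht : 0 < (t : ℝ)) (ht' : 0 < (t' : ℝ)) :
    c.pt u' l t' ∈ (F.stratumAt (c.pt u l t)).carrier := by
  refine (F.stratumAt (c.pt u l t)).subset_of_isPreconnected (c.isPreconnected_ray hC hCU l) ?_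
    ⟨u, t, hu, ht, rfl⟩ (F.mem_stratumAt _) ⟨u', t', hu', ht', rfl⟩
  rintro _ ⟨v, r, -, hr, rfl⟩
  change (F.level (c.pt v l r) : ℤ) = F.level (c.pt u l t)
  rw [c.level_pt v l hr, c.level_pt u l ht]

theorem _root_.CSCoarsening.ConeChart.subset_stratumAt {x : X} (c : ConeChart F x) {C : Set X}
    (hC : IsPreconnected C) (hCU : C ⊆ c.U) {y : X} (hy : y ∈ C) :
    C ⊆ (F.stratumAt y).carrier := by
  refine (F.stratumAt y).subset_of_isPreconnected hC (fun z hz => ?_) hy (F.mem_stratumAt y)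
  change (F.level z : ℤ) = F.level y
  rw [F.mem_layer_iff.1 (c.subset_layer (hCU hz)), F.mem_layer_iff.1 (c.subset_layer (hCU hy))]

theorem zero_mem_closure_Ioo :
    (⟨0, by norm_num⟩ : Ico (0 : ℝ) 1) ∈ closure {t : Ico (0 : ℝ) 1 | 0 < (t : ℝ)} := by
  rw [Metric.mem_closure_iff]
  intro ε hε
  have h0 : 0 < min (ε / 2) (1 / 2) := by positivity
  refine ⟨⟨min (ε / 2) (1 / 2), h0.le, (min_le_right _ _).trans_lt (by norm_num)⟩, h0, ?_⟩
  rw [Subtype.dist_eq, Real.dist_eq]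
  simp only [zero_sub, abs_neg, abs_of_pos h0]
  exact (min_le_left _ _).trans_lt (by linarith)

/-- Small neighbourhoods of a point only meet strata whose closure contains a fixed neighbourhood
of the point in its layer. -/
theorem exists_nhds_subset_closure (hF : IsCSSet F) (x : X) {W : Set X} (hW : W ∈ 𝓝 x) :
    ∃ N ∈ 𝓝 x, N ⊆ W ∧ ∃ C ∈ 𝓝[F.layer (F.level x)] x,
      ∀ y ∈ N, F.level x ≤ F.level y ∧ C ⊆ closure (F.stratumAt y).carrier := by
  rcases (F.level_le x).lt_or_eq with hlt | heq
  · obtain ⟨c⟩ := hF.nonempty_coneChart hlt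
    obtain ⟨C, ε, hε, hε1, hCU, hxC, hCp, hC, hsub⟩ := c.exists_truncated_subset (hF.manifold _) hW
    refine ⟨_, c.truncated_mem_nhds hC hε, hsub, C, hC, ?_⟩
    rintro _ ⟨u, l, t, hu, ht, rfl⟩
    rcases t.2.1.lt_or_eq with h0 | h0
    · refine ⟨?_, fun v hv => ?_⟩
      · rw [c.level_pt u l h0]
        exact (c.lt_linkLevel l).le
      -- Over any `v` in `C`, sliding along the ray of `l` down to the apex stays in the stratum of
      -- `y` and tends to `v`.
      · have h1 : Continuous fun t => c.pt ⟨v, hCU hv⟩ l t :=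
          c.continuous_pt.comp (by fun_prop : Continuous fun t : Ico (0 : ℝ) 1 =>
            ((⟨v, hCU hv⟩ : c.U), l, t))
        have h2 := map_mem_closure h1 zero_mem_closure_Ioo
          (t := (F.stratumAt (c.pt u l t)).carrier)
          fun t' ht' => c.ray_subset_stratumAt hCp hCU hu hv l h0 ht'
        rwa [c.pt_zero (t := ⟨0, by norm_num⟩) ⟨v, hCU hv⟩ l rfl] at h2
    · have h1 := c.pt_zero u l h0.symm
      refine ⟨(c.level_pt_zero u l h0.symm).ge, ?_⟩
      rw [h1]
      exact (c.subset_stratumAt hCp hCU hu).trans subset_closure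
  · obtain ⟨C, hC, hCW, hxC, hCl, hCp⟩ := hF.regular_mem_nhds heq hW
    refine ⟨C, hC, hCW, C, mem_nhdsWithin_of_mem_nhds hC, fun y hy => ⟨by rw [heq, hCl y hy], ?_⟩⟩
    refine Subset.trans ?_ subset_closure
    refine (F.stratumAt y).subset_of_isPreconnected hCp.isConnected.isPreconnected
      (fun z hz => ?_) hy (F.mem_stratumAt y)
    change (F.level z : ℤ) = F.level y
    rw [hCl z hz, hCl y hy]

/-- The frontier condition. -/
theorem le_of_mem_closure (hF : IsCSSet F) {S Q : F.Stratum} {x : X} (hx : x ∈ S.carrier)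
    (hxQ : x ∈ closure Q.carrier) : S ≤ Q := by
  intro y hy
  -- Membership in the closure of `Q` is locally constant on the connected set `S`: closedness
  -- handles the points outside, and `exists_nhds_subset_closure` those inside.
  refine (S.isPreconnected.induction₂ (fun a b => a ∈ closure Q.carrier ↔ b ∈ closure Q.carrier)
    ?_ (fun _ _ _ _ _ _ h1 h2 => h1.trans h2) (fun _ _ _ _ h => h.symm) hx hy).1 hxQ
  intro a ha
  by_cases haQ : a ∈ closure Q.carrier
  · obtain ⟨N, hN, -, C, hC, h⟩ := hF.exists_nhds_subset_closure a Filter.univ_mem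
    obtain ⟨q, hqN, hq⟩ := mem_closure_iff_nhds.1 haQ N hN
    have h1 := (h q hqN).2
    rw [← Filtration.Stratum.eq_stratumAt hq] at h1
    rw [Filtration.Stratum.level_eq ha] at hC
    filter_upwards [nhdsWithin_mono _ S.subset_layer hC] with b hb
    exact iff_of_true haQ (h1 hb)
  · filter_upwards [mem_nhdsWithin_of_mem_nhds (isClosed_closure.isOpen_compl.mem_nhds haQ)]
      with b hb
    exact iff_of_false haQ hb

/-- Regular points are dense. -/
theorem exists_regular_mem (hF : IsCSSet F) (x : X) {W : Set X} (hW : W ∈ 𝓝 x) :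
    ∃ y ∈ W, F.level y = n := by
  rcases (F.level_le x).lt_or_eq with hlt | heq
  · obtain ⟨c⟩ := hF.nonempty_coneChart hlt
    obtain ⟨C, ε, hε, hε1, hCU, hxC, -, -, hsub⟩ := c.exists_truncated_subset (hF.manifold _) hW
    obtain ⟨l, hl⟩ := c.exists_linkLevel
    let t : Ico (0 : ℝ) 1 := ⟨ε / 2, by positivity, by linarith⟩
    refine ⟨c.pt ⟨x, c.mem⟩ l t, hsub ⟨_, l, t, hxC, half_lt_self hε, rfl⟩, ?_⟩
    rw [c.level_pt _ l (half_pos hε : 0 < (t : ℝ)), hl]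
  · exact ⟨x, mem_of_mem_nhds hW, heq⟩

/-- Local finiteness is required only at points of `K`, because `locallyFinite_strata` uses this
inductively on an image of the link before the apex is settled. -/
theorem finite_strata_of_isCompact_of_locally {K : Set X} (hK : IsCompact K)
    (h : ∀ x ∈ K, ∃ N ∈ 𝓝 x, {S : F.Stratum | (S.carrier ∩ N).Nonempty}.Finite) :
    {S : F.Stratum | (S.carrier ∩ K).Nonempty}.Finite := by
  refine hK.induction_on (p := fun K => {S : F.Stratum | (S.carrier ∩ K).Nonempty}.Finite)
    ?_ ?_ ?_ ?_
  · simp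
  · intro s t hst ht
    exact ht.subset fun S hS => hS.mono (inter_subset_inter_right _ hst)
  · intro s t hs ht
    refine (hs.union ht).subset fun S hS => ?_
    rw [mem_ofPred_eq, inter_union_distrib_left, union_nonempty] at hS
    exact hS
  · intro x hx
    obtain ⟨N, hN, hf⟩ := h x hx
    exact ⟨N, mem_nhdsWithin_of_mem_nhds hN, hf⟩

/-- The strata are locally finite. -/
theorem locallyFinite_strata (hF : IsCSSet F) (x : X) :
    ∃ N ∈ 𝓝 x, {S : F.Stratum | (S.carrier ∩ N).Nonempty}.Finite := by
  induction hk : n - F.level x using Nat.strong_induction_on generalizing x with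
  | _ k ih =>
  rcases (F.level_le x).lt_or_eq with hlt | heq
  · obtain ⟨c⟩ := hF.nonempty_coneChart hlt
    obtain ⟨C, ε, hε, hε1, hCU, hxC, hCp, hC, -⟩ :=
      c.exists_truncated_subset (hF.manifold _) (Filter.univ_mem (f := 𝓝 x))
    -- The slice at height `ε / 2` over `x` is compact, and its points have smaller codimension than
    -- `x`. A stratum meeting the truncated neighbourhood is that of `x` or follows its ray to this
    -- slice.
    let t : Ico (0 : ℝ) 1 := ⟨ε / 2, by positivity, by linarith⟩
    have ht : 0 < (t : ℝ) := half_pos hε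
    have hcomp : IsCompact (range fun l => c.pt ⟨x, c.mem⟩ l t) :=
      isCompact_range (c.continuous_pt.comp (by fun_prop : Continuous fun l : c.L =>
        ((⟨x, c.mem⟩ : c.U), l, t)))
    have hfin := finite_strata_of_isCompact_of_locally (F := F) hcomp (by
      rintro _ ⟨l, rfl⟩
      have h1 : F.level ((fun l => c.pt ⟨x, c.mem⟩ l t) l) = c.linkLevel l := c.level_pt _ l ht
      have h2 := c.lt_linkLevel l
      exact ih _ (by omega) _ rfl)
    refine ⟨_, c.truncated_mem_nhds hC hε, (hfin.insert (F.stratumAt x)).subset ?_⟩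
    rintro S ⟨_, hS, u, l, r, hu, hr, rfl⟩
    rcases r.2.1.lt_or_eq with h0 | h0
    · right
      refine ⟨c.pt ⟨x, c.mem⟩ l t, ?_, l, rfl⟩
      rw [Filtration.Stratum.eq_stratumAt hS]
      exact c.ray_subset_stratumAt hCp hCU hu hxC l h0 ht
    · left
      rw [c.pt_zero u l h0.symm] at hS
      exact Filtration.Stratum.eq_of_mem hS (c.subset_stratumAt hCp hCU hxC hu)
  · obtain ⟨C, hC, -, hxC, hCl, hCp⟩ := hF.regular_mem_nhds heq Filter.univ_mem
    refine ⟨C, hC, (finite_singleton (F.stratumAt x)).subset ?_⟩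
    rintro S ⟨y, hyS, hyC⟩
    refine Filtration.Stratum.eq_of_mem hyS ((F.stratumAt x).subset_of_isPreconnected
      hCp.isConnected.isPreconnected (fun z hz => ?_) hxC (F.mem_stratumAt x) hyC)
    change (F.level z : ℤ) = F.level x
    rw [hCl z hz, heq]

/-- A compact subset meets finitely many strata. -/
theorem finite_strata_of_isCompact (hF : IsCSSet F) {K : Set X} (hK : IsCompact K) :
    {S : F.Stratum | (S.carrier ∩ K).Nonempty}.Finite :=
  finite_strata_of_isCompact_of_locally hK fun x _ => hF.locallyFinite_strata x

/-- In an `n`-manifold, a layer of codimension at least two does not separate locally. -/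
theorem exists_nhds_isPreconnected_diff (hF : IsCSSet F) {x : X} (hx : F.level x + 2 ≤ n)
    {Y : Set X} (hY : Nonempty (ChartedSpace (EuclideanSpace ℝ (Fin n)) Y)) (hxY : Y ∈ 𝓝 x)
    {W : Set X} (hW : W ∈ 𝓝 x) :
    ∃ N ∈ 𝓝 x, N ⊆ W ∧ IsPreconnected (N \ F.layer (F.level x)) := by
  obtain ⟨c⟩ := hF.nonempty_coneChart (by omega : F.level x < n)
  obtain ⟨C, ε, hε, hε1, hCU, -, hCp, hC, hsub⟩ := c.exists_truncated_subset (hF.manifold _) hW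
  have := c.preconnectedSpace_link (hF.manifold _) hY hxY hx
  exact ⟨_, c.truncated_mem_nhds hC hε, hsub, c.isPreconnected_truncated_diff hCp hCU hε1⟩

end IsCSSet

end CSCoarsening

/-! ### Comparison of strata in a coarsening. -/

namespace CSCoarsening
open Set Topology

theorem exists_max_level {X : Type*} [TopologicalSpace X] {n : ℕ} {F : Filtration X n} {A : Set X}
    (hA : A.Nonempty) : ∃ y ∈ A, ∀ z ∈ A, F.level z ≤ F.level y := by
  have hfin : (F.level '' A).Finite :=
    (finite_Iic n).subset (by rintro _ ⟨z, -, rfl⟩; exact F.level_le z)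
  obtain ⟨_, ⟨y, hy, rfl⟩, hmax⟩ := exists_max_image _ id hfin (hA.image _)
  exact ⟨y, hy, fun z hz => hmax _ ⟨z, hz, rfl⟩⟩

namespace IsCSCoarsening

variable {X : Type u} [TopologicalSpace X]

/-- The two structures of a coarsening have the same dimension. -/
theorem dim_eq {n m : ℕ} {𝒮 : Filtration X n} {𝒯 : Filtration X m} (h : IsCSCoarsening 𝒮 𝒯) :
    n = m := by
  obtain ⟨x, hx⟩ := h.isCSSet_fine.isFilteredSpace.exists_level_eq
  -- At a point regular for both structures, the two regular parts have the same germ.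
  obtain ⟨y, hy, hyT⟩ := h.isCSSet_coarse.exists_regular_mem x (𝒮.isOpen_regular.mem_nhds hx)
  refine dim_eq_of_nhdsWithin_eq h.isCSSet_fine.manifold_dim h.isCSSet_coarse.manifold_dim
    hy hyT ?_
  rw [𝒮.isOpen_regular.nhdsWithin_eq hy, 𝒯.isOpen_regular.nhdsWithin_eq hyT]

variable {n : ℕ} {𝒮 𝒯 : Filtration X n}

theorem subset_of_mem (h : IsCSCoarsening 𝒮 𝒯) {S : 𝒮.Stratum} {T : 𝒯.Stratum} {x : X}
    (hS : x ∈ S.carrier) (hT : x ∈ T.carrier) : S.carrier ⊆ T.carrier := by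
  obtain ⟨A, hA⟩ := h.union T
  rw [hA] at hT ⊢
  obtain ⟨S', hS', hx⟩ := mem_iUnion₂.1 hT
  obtain rfl := Filtration.Stratum.eq_of_mem hS hx
  exact subset_biUnion_of_mem hS'

/-- Where the `𝒮`-level is constant on `T` near `y`, the `𝒮`-layer and the `𝒯`-layer of `y` have the
same germ, so invariance of dimension applies. -/
theorem level_eq_of_eventually (h : IsCSCoarsening 𝒮 𝒯) {T : 𝒯.Stratum} {y : X}
    (hy : y ∈ T.carrier) (hev : ∀ᶠ z in 𝓝[T.carrier] y, 𝒮.level z = 𝒮.level y) :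
    (𝒮.level y : ℤ) = T.dim := by
  have hl := Filtration.Stratum.level_eq hy
  have hT := h.isCSSet_coarse.stratum_mem_nhdsWithin T hy
  have hQ := h.isCSSet_fine.stratum_mem_nhdsWithin (𝒮.stratumAt y) (𝒮.mem_stratumAt y)
  have hTl := T.subset_layer
  rw [← hl] at hT hTl ⊢
  refine congrArg _ (dim_eq_of_nhdsWithin_eq (h.isCSSet_fine.manifold _)
    (h.isCSSet_coarse.manifold _) (𝒮.mem_layer_iff.2 rfl) (𝒯.mem_layer_iff.2 rfl)
    (z := y) (le_antisymm ?_ ?_))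
  · exact (nhdsWithin_le_of_mem hQ).trans
      (nhdsWithin_mono _ ((h.subset_of_mem (𝒮.mem_stratumAt y) hy).trans hTl))
  · refine (nhdsWithin_le_of_mem hT).trans (nhdsWithin_le_of_mem ?_)
    filter_upwards [hev] with z hz
    rw [𝒮.mem_layer_iff, hz]

/-- The strata of `𝒮` of maximal dimension are dense in a stratum of `𝒯`. -/
theorem exists_level_eq (h : IsCSCoarsening 𝒮 𝒯) {T : 𝒯.Stratum} {x : X} (hx : x ∈ T.carrier)
    {W : Set X} (hW : W ∈ 𝓝 x) :
    ∃ y ∈ W, y ∈ T.carrier ∧ (𝒮.level y : ℤ) = T.dim := by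
  obtain ⟨O, hOW, hO, hxO⟩ := mem_nhds_iff.1 hW
  -- The level cannot drop near a point, so it is locally constant on `T` at a point where it is
  -- maximal.
  obtain ⟨y, ⟨hyO, hyT⟩, hmax⟩ : ∃ y ∈ O ∩ T.carrier, ∀ z ∈ O ∩ T.carrier,
      𝒮.level z ≤ 𝒮.level y :=
    exists_max_level ⟨x, hxO, hx⟩
  refine ⟨y, hOW hyO, hyT, h.level_eq_of_eventually hyT ?_⟩
  filter_upwards [mem_nhdsWithin_of_mem_nhds (hO.mem_nhds hyO), self_mem_nhdsWithin,
    mem_nhdsWithin_of_mem_nhds ((𝒮.isOpen_le_level (𝒮.level y)).mem_nhds (le_refl (𝒮.level y)))] with z h1 h2 h3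
  exact le_antisymm (hmax z ⟨h1, h2⟩) h3

/-- The maximal `𝒮`-level on `T` is attained where the level is locally constant, hence equals
`T.dim`. -/
theorem level_le_dim (h : IsCSCoarsening 𝒮 𝒯) {T : 𝒯.Stratum} {x : X} (hx : x ∈ T.carrier) :
    (𝒮.level x : ℤ) ≤ T.dim := by
  obtain ⟨y, hyT, hmax⟩ : ∃ y ∈ T.carrier, ∀ z ∈ T.carrier, 𝒮.level z ≤ 𝒮.level y :=
    exists_max_level ⟨x, hx⟩
  rw [← h.level_eq_of_eventually hyT]
  · exact_mod_cast hmax x hx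
  filter_upwards [self_mem_nhdsWithin,
    mem_nhdsWithin_of_mem_nhds ((𝒮.isOpen_le_level (𝒮.level y)).mem_nhds (le_refl (𝒮.level y)))] with z h2 h3
  exact le_antisymm (hmax z h2) h3

/-- Full-dimensional strata are dense in `T`, and one passing close enough to a point of `S` has
that point in its closure. Such `Q` are the reference strata for (K1) and (K2). -/
theorem exists_le_of_subset (h : IsCSCoarsening 𝒮 𝒯) {S : 𝒮.Stratum} {T : 𝒯.Stratum}
    (hST : S.carrier ⊆ T.carrier) :
    ∃ Q : 𝒮.Stratum, Q.carrier ⊆ T.carrier ∧ Q.dim = T.dim ∧ S ≤ Q := by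
  obtain ⟨x, hx⟩ := S.nonempty
  obtain ⟨N, hN, -, C, hC, hNC⟩ := h.isCSSet_fine.exists_nhds_subset_closure x Filter.univ_mem
  obtain ⟨y, hyN, hyT, hy⟩ := h.exists_level_eq (hST hx) hN
  refine ⟨𝒮.stratumAt y, h.subset_of_mem (𝒮.mem_stratumAt y) hyT, hy,
    h.isCSSet_fine.le_of_mem_closure hx ((hNC y hyN).2 ?_)⟩
  exact mem_of_mem_nhdsWithin (𝒮.mem_layer_iff.2 rfl) hC

theorem isSingular_of_subset (h : IsCSCoarsening 𝒮 𝒯) {S : 𝒮.Stratum} {T : 𝒯.Stratum}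
    (hT : T.IsSingular) (hST : S.carrier ⊆ T.carrier) : S.IsSingular := by
  obtain ⟨x, hx⟩ := S.nonempty
  intro hS
  have h1 := h.level_le_dim (hST hx)
  rw [Filtration.Stratum.level_eq hx, hS] at h1
  exact hT (le_antisymm T.dim_le h1)

end IsCSCoarsening

theorem topValue_congr {X : Type u} [TopologicalSpace X] {n : ℕ} {𝒮 𝒯 : Filtration X n}
    {S : 𝒮.Stratum} {T : 𝒯.Stratum} (h : S.dim = T.dim) : topValue S = topValue T := by
  have hr : S.IsRegular ↔ T.IsRegular := by
    rw [Filtration.Stratum.IsRegular, Filtration.Stratum.IsRegular, h]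
  by_cases hT : T.IsRegular
  · rw [topValue, topValue, if_pos hT, if_pos (hr.2 hT)]
  · rw [topValue, topValue, if_neg hT, if_neg (mt hr.1 hT), Filtration.Stratum.codim,
      Filtration.Stratum.codim, h]

/-! ### Extended integers and allowability bounds. -/

section Extended

@[simp] theorem extNeg_bot : extNeg ⊥ = ⊤ := rfl
@[simp] theorem extNeg_top : extNeg ⊤ = ⊥ := rfl
@[simp] theorem extNeg_coe (a : ℤ) : extNeg (a : EInt) = ((-a : ℤ) : EInt) := rfl
theorem coe_add_coe (a b : ℤ) : (a : EInt) + (b : EInt) = ((a + b : ℤ) : EInt) := rfl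
@[simp] theorem coe_add_top (a : ℤ) : (a : EInt) + (⊤ : EInt) = ⊤ := rfl
@[simp] theorem coe_add_bot (a : ℤ) : (a : EInt) + (⊥ : EInt) = ⊥ := rfl
@[simp] theorem bot_add_coe (a : ℤ) : (⊥ : EInt) + (a : EInt) = ⊥ := rfl

/-- Used with `a`, `b` the top values of `S` and `T`, and `x`, `y` the values of `p` and its
pushforward: the allowability bound for `S` is then at most the one for `T`. -/
theorem allowableBound_mono (k a b : ℤ) {x y : EInt} (h : x ≤ y + ((a - b : ℤ) : EInt)) :
    (k : EInt) + extNeg ((a : EInt) + extNeg x) ≤ (k : EInt) + extNeg ((b : EInt) + extNeg y) := by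
  induction x using WithBotTop.rec with
  | bot => simp
  | coe s =>
    induction y using WithBotTop.rec with
    | bot => simp at h
    | coe t =>
      rw [coe_add_coe, WithBotTop.coe_le_coe] at h
      simp only [extNeg_coe, coe_add_coe, WithBotTop.coe_le_coe]
      omega
    | top => simp
  | top =>
    induction y using WithBotTop.rec with
    | bot => simp at h
    | coe t => simp [coe_add_coe] at h
    | top => simp

/-- A perversity below the top one has nonnegative dual, so with `k = dim Δ - 2` the bound is
negative in dimensions at most one. -/
theorem allowableBound_le (k a : ℤ) {x : EInt} (h : x ≤ (a : EInt)) :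
    (k : EInt) + extNeg ((a : EInt) + extNeg x) ≤ (k : EInt) := by
  induction x using WithBotTop.rec with
  | bot => simp
  | coe s =>
    rw [WithBotTop.coe_le_coe] at h
    simp only [extNeg_coe, coe_add_coe, WithBotTop.coe_le_coe]
    omega
  | top => simp at h

end Extended

/-! ### Consequences of the `K`-conditions. -/

section Perversity

variable {X : Type u} [TopologicalSpace X] {n : ℕ} {𝒮 𝒯 : Filtration X n}
  {p : Perversity 𝒮}

/-- By (K1) every stratum in `T` has value at least that of a full-dimensional one above it, and by
(K2) the full-dimensional ones share one value. So the infimum is attained at each of them. -/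
theorem IsKPerversity.pushforward_eq (hK : IsKPerversity 𝒯 p) (h : IsCSCoarsening 𝒮 𝒯)
    {T : 𝒯.Stratum} (hT : T.IsSingular) {Q : 𝒮.Stratum} (hQ : Q.carrier ⊆ T.carrier)
    (hd : Q.dim = T.dim) : p.pushforward 𝒯 T = p Q := by
  have h1 : p.pushforward 𝒯 T = ⨅ (Q : 𝒮.Stratum) (_ : Q.carrier ⊆ T.carrier), p Q := if_neg hT
  rw [h1]
  refine le_antisymm (iInf₂_le Q hQ) (le_iInf₂ fun S hS => ?_)
  obtain ⟨Q', hQ', hd', hle⟩ := h.exists_le_of_subset hS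
  rw [← hK.k2 Q Q' (hd.trans hd'.symm) ⟨T, hQ, hQ'⟩]
  exact hK.k1_left S Q' hle ⟨T, hS, hQ'⟩

/-- The upper half of (K1) against a full-dimensional stratum, whose top value is that of `T`. -/
theorem IsKPerversity.le_pushforward_add (hK : IsKPerversity 𝒯 p) (h : IsCSCoarsening 𝒮 𝒯)
    {T : 𝒯.Stratum} (hT : T.IsSingular) {S : 𝒮.Stratum} (hS : S.carrier ⊆ T.carrier) :
    p S ≤ p.pushforward 𝒯 T + ((topValue S - topValue T : ℤ) : EInt) := by
  obtain ⟨Q, hQ, hd, hle⟩ := h.exists_le_of_subset hS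
  rw [hK.pushforward_eq h hT hQ hd, ← topValue_congr hd]
  exact hK.k1_right S Q hle ⟨T, hS, hQ⟩

theorem IsKPerversity.pushforward_le_top (hK : IsKPerversity 𝒯 p) (h : IsCSCoarsening 𝒮 𝒯)
    (hp : p ≤ topPerversity 𝒮) : p.pushforward 𝒯 ≤ topPerversity 𝒯 := by
  intro T
  by_cases hT : T.IsRegular
  · rw [(p.pushforward 𝒯).regular T hT, (topPerversity 𝒯).regular T hT]
  · obtain ⟨x, hx⟩ := T.nonempty
    obtain ⟨Q, hQ, hd, -⟩ := h.exists_le_of_subset (h.subset_of_mem (𝒮.mem_stratumAt x) hx)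
    rw [hK.pushforward_eq h hT hQ hd]
    refine (hp Q).trans ?_
    change ((topValue Q : ℤ) : EInt) ≤ (topValue T : ℤ)
    rw [topValue_congr hd]

/-- A regular stratum of `𝒯` contains no stratum of `𝒮` of codimension one. -/
theorem IsKPerversity.level_add_one_ne (hK : IsKPerversity 𝒯 p) (h : IsCSCoarsening 𝒮 𝒯) {x : X}
    (hx : 𝒯.level x = n) : 𝒮.level x + 1 ≠ n := by
  intro hx1
  set S := 𝒮.stratumAt x
  set T := 𝒯.stratumAt x
  have hST : S.carrier ⊆ T.carrier := h.subset_of_mem (𝒮.mem_stratumAt x) (𝒯.mem_stratumAt x)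
  obtain ⟨Q, hQ, hd, hle⟩ := h.exists_le_of_subset hST
  have hSd : S.dim = (n : ℤ) - 1 := by
    change ((𝒮.level x : ℕ) : ℤ) = n - 1
    omega
  have hTd : T.dim = n := by
    change ((𝒯.level x : ℕ) : ℤ) = n
    omega
  have hQr : Q.IsRegular := hd.trans hTd
  -- With `p Q = 0`, the two halves of (K1) give `0 ≤ codim S - 2 = -1`.
  have h1 := (hK.k1_left S Q hle ⟨T, hST, hQ⟩).trans (hK.k1_right S Q hle ⟨T, hST, hQ⟩)
  have hSs : ¬ S.IsRegular := fun hr => by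
    have : S.dim = n := hr
    omega
  rw [p.regular Q hQr, coe_add_coe, WithBotTop.coe_le_coe] at h1
  simp only [topValue, hSs, hQr, if_true, if_false, Filtration.Stratum.codim] at h1
  omega

end Perversity

/-! ### Polyhedral dimension and the inclusion of Gajer spaces. -/

section Allowable

theorem InPolyhedron.mono {k : ℕ} {A : Set (stdSimplex ℝ (Fin (k + 1)))} {r s : ℕ}
    (h : InPolyhedron A r) (hrs : r ≤ s) : InPolyhedron A s := by
  obtain ⟨𝒞, hf, hC, hA⟩ := h
  exact ⟨𝒞, hf, fun C hCm => ⟨(hC C hCm).1, (hC C hCm).2.trans hrs⟩, hA⟩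

theorem InPolyhedron.union {k : ℕ} {A B : Set (stdSimplex ℝ (Fin (k + 1)))} {r : ℕ}
    (hA : InPolyhedron A r) (hB : InPolyhedron B r) : InPolyhedron (A ∪ B) r := by
  obtain ⟨𝒞, hf, hC, hA⟩ := hA
  obtain ⟨𝒟, hf', hD, hB⟩ := hB
  refine ⟨𝒞 ∪ 𝒟, hf.union hf', ?_, ?_⟩
  · rintro C (h | h)
    · exact hC C h
    · exact hD C h
  · rw [image_union, sUnion_union]
    exact union_subset_union hA hB

theorem PolyDimLE.mono {k : ℕ} {A : Set (stdSimplex ℝ (Fin (k + 1)))} {r s : EInt}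
    (h : PolyDimLE A r) (hrs : r ≤ s) : PolyDimLE A s :=
  h.imp id fun ⟨ℓ, hℓ, hA⟩ => ⟨ℓ, hℓ.trans hrs, hA⟩

theorem PolyDimLE.union {k : ℕ} {A B : Set (stdSimplex ℝ (Fin (k + 1)))} {r : EInt}
    (hA : PolyDimLE A r) (hB : PolyDimLE B r) : PolyDimLE (A ∪ B) r := by
  rcases hA with rfl | ⟨a, ha, hA⟩
  · rwa [empty_union]
  rcases hB with rfl | ⟨b, hb, hB⟩
  · rw [union_empty]
    exact Or.inr ⟨a, ha, hA⟩
  refine Or.inr ⟨max a b, ?_, (hA.mono (le_max_left _ _)).union (hB.mono (le_max_right _ _))⟩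
  rcases max_choice a b with h | h <;> rwa [h]

theorem PolyDimLE.biUnion {k : ℕ} {ι : Type*} {I : Set ι} (hI : I.Finite)
    {A : ι → Set (stdSimplex ℝ (Fin (k + 1)))} {r : EInt} (h : ∀ i ∈ I, PolyDimLE (A i) r) :
    PolyDimLE (⋃ i ∈ I, A i) r := by
  induction I, hI using Set.Finite.induction_on with
  | empty => left; simp
  | insert _ _ ih =>
    rw [biUnion_insert]
    exact (h _ (mem_insert _ _)).union (ih fun i hi => h i (mem_insert_of_mem _ hi))

variable {X : Type u} [TopologicalSpace X] {n : ℕ} {𝒮 𝒯 : Filtration X n}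
  {p : Perversity 𝒮}

/-- The compact image meets finitely many strata of `𝒮`, so the preimage of `T` is a finite union of
preimages of strata, and polyhedral dimension bounds pass to finite unions. -/
theorem IsKPerversity.isAllowable_pushforward (hK : IsKPerversity 𝒯 p) (h : IsCSCoarsening 𝒮 𝒯)
    {k : SimplexCategoryᵒᵖ} {σ : (TopCat.toSSet.obj (TopCat.of X)).obj k} (hσ : IsAllowable p σ) :
    IsAllowable (p.pushforward 𝒯) σ := by
  intro T hT
  set s := TopCat.toSSetObjEquiv (TopCat.of X) k σ with hs
  have hfin := h.isCSSet_fine.finite_strata_of_isCompact (isCompact_range s.continuous)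
  set I : Set 𝒮.Stratum := {S | (S.carrier ∩ range s).Nonempty ∧ S.carrier ⊆ T.carrier} with hI
  have hIf : I.Finite := hfin.subset fun S hS => hS.1
  have hcov : s ⁻¹' T.carrier = ⋃ S ∈ I, s ⁻¹' S.carrier := by
    ext a
    rw [mem_iUnion₂]
    constructor
    · intro ha
      exact ⟨𝒮.stratumAt (s a), ⟨⟨s a, 𝒮.mem_stratumAt _, a, rfl⟩,
        h.subset_of_mem (𝒮.mem_stratumAt _) ha⟩, 𝒮.mem_stratumAt _⟩
    · rintro ⟨S, hS, ha⟩
      exact hS.2 ha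
  rw [hcov]
  refine PolyDimLE.biUnion hIf fun S hS => ?_
  refine (hσ S (h.isSingular_of_subset hT hS.2)).mono ?_
  exact allowableBound_mono _ _ _ (hK.le_pushforward_add h hT hS.2)

theorem IsKPerversity.gajerSpace_le (hK : IsKPerversity 𝒯 p) (h : IsCSCoarsening 𝒮 𝒯) :
    gajerSpace 𝒮 p ≤ gajerSpace 𝒯 (p.pushforward 𝒯) :=
  fun _ _ hσ j δ hδ => hK.isAllowable_pushforward h (hσ j δ hδ)

end Allowable

end CSCoarsening

namespace CSCoarsening
open Set Topology Simplicial

/-! ### Components of the Gajer space as path components of the regular part. -/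

section GajerComponents

variable {X : Type u} [TopologicalSpace X] {n : ℕ} {F : Filtration X n} {p : Perversity F}

theorem isFull_of_regular {k : SimplexCategoryᵒᵖ} {σ : (TopCat.toSSet.obj (TopCat.of X)).obj k}
    (h : ∀ t, F.level (TopCat.toSSetObjEquiv (TopCat.of X) k σ t) = n) : IsFull p σ := by
  intro j δ _ S hS
  left
  rw [← not_nonempty_iff_eq_empty]
  rintro ⟨t, ht⟩
  have h1 := Filtration.Stratum.level_eq ht
  have h2 : F.level (TopCat.toSSetObjEquiv (TopCat.of X) (op j)
      ((TopCat.toSSet.obj (TopCat.of X)).map δ.op σ) t) = n := h (stdSimplex.map δ t)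
  rw [h2] at h1
  exact hS h1.symm

/-- Full simplices of dimension at most one lie in the regular part. -/
theorem IsFull.regular (hp : p ≤ topPerversity F) {k : SimplexCategoryᵒᵖ} (hk : k.unop.len ≤ 1)
    {σ : (TopCat.toSSet.obj (TopCat.of X)).obj k} (hσ : IsFull p σ) (t) :
    F.level (TopCat.toSSetObjEquiv (TopCat.of X) k σ t) = n := by
  have h1 := hσ k.unop (𝟙 _) inferInstance
  rw [op_id, Functor.map_id_apply] at h1
  set x : X := TopCat.toSSetObjEquiv (TopCat.of X) k σ t with hx
  by_contra hne
  have hS : (F.stratumAt x).IsSingular := fun hr => hne (by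
    have : (F.level x : ℤ) = n := hr
    exact_mod_cast this)
  rcases h1 _ hS with h2 | ⟨ℓ, hℓ, -⟩
  · exact (h2 ▸ F.mem_stratumAt x : t ∈ (∅ : Set _))
  -- The natural number `ℓ` would be at most `k - 2 < 0`.
  · have h3 := hℓ.trans (allowableBound_le _ _ (hp (F.stratumAt x)))
    rw [WithBotTop.coe_le_coe] at h3
    change (ℓ : ℤ) ≤ (k.unop.len : ℤ) - 2 at h3
    omega

/-- The point of `X` underlying a vertex of the Gajer space. -/
noncomputable def vertexPoint (v : (gajerSpace F p : SSet.{u}) _⦋0⦌) : X :=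
  TopCat.toSSetObj₀Equiv (X := TopCat.of X) v.1

theorem level_vertexPoint (hp : p ≤ topPerversity F) (v : (gajerSpace F p : SSet.{u}) _⦋0⦌) :
    F.level (vertexPoint v) = n :=
  IsFull.regular hp (by simp) v.2 default

theorem exists_vertexPoint_eq (p : Perversity F) {x : X} (hx : F.level x = n) :
    ∃ v : (gajerSpace F p : SSet.{u}) _⦋0⦌, vertexPoint v = x := by
  refine ⟨⟨(TopCat.toSSetObj₀Equiv (X := TopCat.of X)).symm x, isFull_of_regular fun t => hx⟩, ?_⟩
  exact (TopCat.toSSetObj₀Equiv (X := TopCat.of X)).apply_symm_apply x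

theorem vertexPoint_δ_one (s : (gajerSpace F p : SSet.{u}) _⦋1⦌) :
    vertexPoint ((gajerSpace F p : SSet.{u}).δ 1 s) =
      TopCat.toSSetObj₁Equiv (X := TopCat.of X) s.1 0 := by
  rw [TopCat.toSSetObj₁Equiv_apply_zero]
  rfl

theorem vertexPoint_δ_zero (s : (gajerSpace F p : SSet.{u}) _⦋1⦌) :
    vertexPoint ((gajerSpace F p : SSet.{u}).δ 0 s) =
      TopCat.toSSetObj₁Equiv (X := TopCat.of X) s.1 1 := by
  rw [TopCat.toSSetObj₁Equiv_apply_one]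
  rfl

theorem vertexPoint_injective : Function.Injective (vertexPoint (F := F) (p := p)) := by
  intro v w h
  exact Subtype.ext ((TopCat.toSSetObj₀Equiv (X := TopCat.of X)).injective h)

theorem joinedIn_of_edge (hp : p ≤ topPerversity F) {v w : (gajerSpace F p : SSet.{u}) _⦋0⦌}
    (e : SSet.Edge v w) : JoinedIn {x | F.level x = n} (vertexPoint v) (vertexPoint w) := by
  obtain ⟨s, hsv, hsw⟩ : ∃ s : (gajerSpace F p : SSet.{u}) _⦋1⦌,
      (gajerSpace F p : SSet.{u}).δ 1 s = v ∧ (gajerSpace F p : SSet.{u}).δ 0 s = w :=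
    ⟨e.edge, e.src_eq, e.tgt_eq⟩
  rw [← hsv, ← hsw, vertexPoint_δ_one, vertexPoint_δ_zero]
  have hcont : Continuous (TopCat.toSSetObj₁Equiv (X := TopCat.of X) s.1) :=
    (TopCat.toSSetObj₁Equiv (X := TopCat.of X) s.1).hom.continuous
  have hreg : ∀ t, F.level (TopCat.toSSetObj₁Equiv (X := TopCat.of X) s.1 t : X) = n := fun t =>
    IsFull.regular hp (by simp) s.2 _
  refine ⟨⟨⟨fun t => TopCat.toSSetObj₁Equiv (X := TopCat.of X) s.1 (ULift.up t),
    hcont.comp continuous_uliftUp⟩, rfl, rfl⟩, fun t => hreg _⟩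

/-- A path in the regular part is a full edge for every perversity; only the converse,
`joinedIn_of_edge`, needs `p ≤ t`. -/
theorem nonempty_edge {v w : (gajerSpace F p : SSet.{u}) _⦋0⦌}
    (h : JoinedIn {x | F.level x = n} (vertexPoint v) (vertexPoint w)) :
    Nonempty (SSet.Edge v w) := by
  obtain ⟨γ, hγ⟩ := h
  let f : TopCat.I ⟶ TopCat.of X := TopCat.ofHom ⟨fun t => γ t.down,
    γ.continuous.comp continuous_uliftDown⟩
  let s : (gajerSpace F p : SSet.{u}) _⦋1⦌ :=
    ⟨(TopCat.toSSetObj₁Equiv (X := TopCat.of X)).symm f, isFull_of_regular fun t => hγ _⟩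
  have hs : TopCat.toSSetObj₁Equiv (X := TopCat.of X) s.1 = f := Equiv.apply_symm_apply _ _
  refine ⟨SSet.Edge.mk s (vertexPoint_injective ?_) (vertexPoint_injective ?_)⟩
  · rw [vertexPoint_δ_one, hs]
    exact γ.source
  · rw [vertexPoint_δ_zero, hs]
    exact γ.target

/-- The components of the Gajer space are the path components of the regular part. -/
theorem π₀_mk_eq_mk_iff (hp : p ≤ topPerversity F) (v w : (gajerSpace F p : SSet.{u}) _⦋0⦌) :
    SSet.π₀.mk v = SSet.π₀.mk w ↔ JoinedIn {x | F.level x = n} (vertexPoint v) (vertexPoint w) := by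
  constructor
  · intro h
    rw [SSet.π₀.mk_eq_mk_iff] at h
    induction h with
    | rel v w e =>
      obtain ⟨e⟩ := e
      exact joinedIn_of_edge hp e
    | refl v => exact JoinedIn.refl (level_vertexPoint hp v)
    | symm v w _ ih => exact ih.symm
    | trans u v w _ _ ih1 ih2 => exact ih1.trans ih2
  · intro h
    obtain ⟨e⟩ := nonempty_edge h
    exact SSet.π₀.sound e

end GajerComponents

/-! ### Comparison of the two regular parts. -/

namespace IsCSCoarsening

variable {X : Type u} [TopologicalSpace X] {n : ℕ} {𝒮 𝒯 : Filtration X n} {p : Perversity 𝒮}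

/-- Removing the singular strata of `𝒮` from an open connected subset of the regular part of `𝒯`
preserves connectedness. -/
theorem isPreconnected_inter_level (h : IsCSCoarsening 𝒮 𝒯)
    (hcodim : ∀ x, 𝒯.level x = n → 𝒮.level x + 1 ≠ n) {K : Set X} (hK : IsPreconnected K)
    (hKo : IsOpen K) (hKT : K ⊆ {x | 𝒯.level x = n}) (k : ℕ) (hk : k ≤ n) :
    IsPreconnected (K ∩ {x | k ≤ 𝒮.level x}) := by
  -- Layers are removed in increasing dimension, so what remains is open at each stage. Layer `k`
  -- has codimension at least two where it meets the set: `k < n`, and `hcodim` excludes `k + 1 =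
  -- n`.
  induction k with
  | zero => simpa using hK
  | succ k ih =>
    have ih := ih (by omega)
    have ho : IsOpen (K ∩ {x | k ≤ 𝒮.level x}) := hKo.inter (𝒮.isOpen_le_level k)
    have heq : K ∩ {x | k + 1 ≤ 𝒮.level x} = (K ∩ {x | k ≤ 𝒮.level x}) \ 𝒮.layer k := by
      ext x
      simp only [mem_inter_iff, mem_ofPred_eq, mem_sdiff, 𝒮.mem_layer_iff]
      constructor
      · rintro ⟨h1, h2⟩
        exact ⟨⟨h1, by omega⟩, by omega⟩
      · rintro ⟨⟨h1, h2⟩, h3⟩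
        exact ⟨h1, by omega⟩
    rw [heq]
    refine isPreconnected_diff_of_locally ih ho ?_ ?_
    · intro a ha hak
      have hlev : 𝒮.level a = k := by exact_mod_cast 𝒮.mem_layer_iff.1 hak
      have haT : 𝒯.level a = n := hKT ha.1
      have hne := hcodim a haT
      have := h.isCSSet_fine.exists_nhds_isPreconnected_diff (x := a) (by omega)
        h.isCSSet_coarse.manifold_dim (𝒯.isOpen_regular.mem_nhds haT) (ho.mem_nhds ha)
      rwa [hlev] at this
    · intro a ha hak
      rw [Filter.frequently_iff]
      intro W hW
      obtain ⟨y, hy, hyn⟩ := h.isCSSet_fine.exists_regular_mem a hW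
      refine ⟨y, hy, fun hyk => ?_⟩
      have := 𝒮.mem_layer_iff.1 hyk
      omega

theorem isOpen_stratumAt_and_subset_regular (h : IsCSCoarsening 𝒮 𝒯) (x : X) (hx : 𝒯.level x = n) :
    IsOpen (𝒯.stratumAt x).carrier ∧ (𝒯.stratumAt x).carrier ⊆ {x | 𝒯.level x = n} := by
  have hsub : (𝒯.stratumAt x).carrier ⊆ {x | 𝒯.level x = n} := by
    intro y hy
    have h1 : (𝒯.level y : ℤ) = 𝒯.level x := Filtration.Stratum.level_eq hy
    simp only [mem_ofPred_eq]
    omega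
  refine ⟨isOpen_iff_mem_nhds.2 fun y hy => ?_, hsub⟩
  have h1 := h.isCSSet_coarse.stratum_mem_nhdsWithin _ hy
  have h2 : (𝒯.stratumAt x).dim = n := by
    change (𝒯.level x : ℤ) = n
    rw [hx]
  rwa [h2, 𝒯.layer_dim_eq, 𝒯.isOpen_regular.nhdsWithin_eq (hsub hy)] at h1

/-- Injectivity on components: the path stays in one regular stratum of `𝒯`, whose `𝒮`-regular part
is connected and locally path connected. -/
theorem joinedIn_fine (h : IsCSCoarsening 𝒮 𝒯)
    (hcodim : ∀ x, 𝒯.level x = n → 𝒮.level x + 1 ≠ n) {x y : X} (hx : 𝒮.level x = n)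
    (hy : 𝒮.level y = n) (hxy : JoinedIn {z | 𝒯.level z = n} x y) :
    JoinedIn {z | 𝒮.level z = n} x y := by
  have hxT : 𝒯.level x = n := hxy.source_mem
  obtain ⟨ho, hsub⟩ := h.isOpen_stratumAt_and_subset_regular x hxT
  have hyK : y ∈ (𝒯.stratumAt x).carrier := by
    obtain ⟨γ, hγ⟩ := hxy
    refine (𝒯.stratumAt x).subset_of_isPreconnected (isPreconnected_range γ.continuous) ?_
      ⟨0, γ.source⟩ (𝒯.mem_stratumAt x) ⟨1, γ.target⟩
    rintro _ ⟨t, rfl⟩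
    change (𝒯.level (γ t) : ℤ) = 𝒯.level x
    rw [show 𝒯.level (γ t) = n from hγ t, hxT]
  have hpre := h.isPreconnected_inter_level hcodim (𝒯.stratumAt x).isPreconnected ho hsub n le_rfl
  refine (joinedIn_of_isPreconnected hpre ?_ ⟨𝒯.mem_stratumAt x, hx.ge⟩ ⟨hyK, hy.ge⟩).mono ?_
  · intro z hz
    have hzn : 𝒮.level z = n := le_antisymm (𝒮.level_le z) hz.2
    obtain ⟨C, hC, hCW, hzC, -, hCp⟩ := h.isCSSet_fine.regular_mem_nhds hzn
      ((ho.inter (𝒮.isOpen_le_level n)).mem_nhds hz)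
    exact ⟨C, mem_nhdsWithin_of_mem_nhds hC, hCW, hzC, hCp⟩
  · intro z hz
    exact le_antisymm (𝒮.level_le z) hz.2

/-- Surjectivity on components: a path connected neighbourhood in the `𝒯`-regular part contains an
`𝒮`-regular point. -/
theorem exists_joinedIn_coarse (h : IsCSCoarsening 𝒮 𝒯) {x : X} (hx : 𝒯.level x = n) :
    ∃ y, 𝒮.level y = n ∧ JoinedIn {z | 𝒯.level z = n} y x := by
  obtain ⟨C, hC, -, hxC, hCn, hCp⟩ := h.isCSSet_coarse.regular_mem_nhds hx Filter.univ_mem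
  obtain ⟨y, hyC, hy⟩ := h.isCSSet_fine.exists_regular_mem x hC
  exact ⟨y, hy, (hCp.joinedIn y hyC x hxC).mono hCn⟩

end IsCSCoarsening

end CSCoarsening

theorem proposition5p4 {X : Type u} [TopologicalSpace X] {n m : ℕ}
    (𝒮 : CSCoarsening.Filtration X n) (𝒯 : CSCoarsening.Filtration X m)
    (hST : CSCoarsening.IsCSCoarsening 𝒮 𝒯)
    (p : CSCoarsening.Perversity 𝒮) (hK : CSCoarsening.IsKPerversity 𝒯 p)
    (hp : p ≤ CSCoarsening.topPerversity 𝒮) :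
    ∃ h : CSCoarsening.gajerSpace 𝒮 p ≤ CSCoarsening.gajerSpace 𝒯 (p.pushforward 𝒯),
      Function.Bijective
        (SSet.mapπ₀ (SSet.Subcomplex.homOfLE h) :
          CSCoarsening.intersectionπ₀ p →
            CSCoarsening.intersectionπ₀ (p.pushforward 𝒯)) := by
  obtain rfl := hST.dim_eq
  have hpT := hK.pushforward_le_top hST hp
  have hle := hK.gajerSpace_le hST
  -- The inclusion leaves underlying points unchanged, so both `π₀` are compared through paths in
  -- `X`.
  have hpt : ∀ v, CSCoarsening.vertexPoint ((SSet.Subcomplex.homOfLE hle).app _ v) =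
      CSCoarsening.vertexPoint v := fun v => rfl
  refine ⟨hle, fun a b hab => ?_, fun b => ?_⟩
  · obtain ⟨v, rfl⟩ := SSet.π₀.mk_surjective a
    obtain ⟨w, rfl⟩ := SSet.π₀.mk_surjective b
    rw [SSet.mapπ₀_mk, SSet.mapπ₀_mk, CSCoarsening.π₀_mk_eq_mk_iff hpT, hpt, hpt] at hab
    rw [CSCoarsening.π₀_mk_eq_mk_iff hp]
    exact hST.joinedIn_fine (fun x hx => hK.level_add_one_ne hST hx)
      (CSCoarsening.level_vertexPoint hp v) (CSCoarsening.level_vertexPoint hp w) hab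
  · obtain ⟨w, rfl⟩ := SSet.π₀.mk_surjective b
    obtain ⟨y, hy, hyw⟩ := hST.exists_joinedIn_coarse (CSCoarsening.level_vertexPoint hpT w)
    obtain ⟨v, rfl⟩ := CSCoarsening.exists_vertexPoint_eq p hy
    refine ⟨SSet.π₀.mk v, ?_⟩
    rw [SSet.mapπ₀_mk, CSCoarsening.π₀_mk_eq_mk_iff hpT, hpt]
    exact hyw
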